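/- Let $\mathcal U(n)$ and $\mathcal H(n)$ be the unitary group and the real space of Hermitian $n\times n$ complex matrices, $\|T\|_1=\operatorname{tr}|T|$ the trace norm, $\|\cdot\|_\infty$ the spectral norm, and, for $A\in\mathcal H(n)$, let $\lambda_1(A)\ge\dots\ge\lambda_n(A)$ be its eigenvalues counted with multiplicity. A piecewise smooth curve $\gamma:[0,1]\to S$, where $S$ is $\mathcal U(n)$, $\mathbb R$ or the circle $\mathbb T=\mathcal U(1)\subset\mathbb C$, is called minimal in $S$ if its length $\int_0^1\|\dot\gamma(t)\|\,dt$ (with respect to the trace norm on $\mathcal U(n)$, and to the absolute value on $\mathbb R$ and $\mathbb T$) is at most that of every piecewise smooth curve in $S$ with the same endpoints. Let $\alpha:[0,1]\to\mathcal U(n)$ be a smooth curve, minimal in $\mathcal U(n)$ for the trace norm, joining $I$ with $e^{iX}$, where $X\in\mathcal H(n)$ and $\|X\|_\infty<\pi$. Then there is a unique smooth curve $Y:[0,1]\to\mathcal H(n)$ such that $\alpha(t)=e^{iY(t)}$ and $\|Y(t)\|_\infty<\pi$ for every $t\in[0,1]$. If moreover the curves $t\mapsto e^{i\lambda_j(Y(t))}$,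 $1\le j\le n$, are piecewise smooth, then for every $j$: 1. the function $t\mapsto\lambda_j(Y(t))$ is monotone (non-decreasing or non-increasing) on $[0,1]$, and it is a minimal curve in $\mathbb R$; 2. the curve $t\mapsto e^{i\lambda_j(Y(t))}$ is minimal in $\mathbb T$. -/

import Mathlib

open scoped ContDiff MatrixOrder Matrix.Norms.L2Operator

noncomputable section

/-- The trace norm `‖T‖₁ = tr |T|`, where `|T| = (T* T)^{1/2}`. -/
def traceNorm {n : ℕ} (T : Matrix (Fin n) (Fin n) ℂ) : ℝ :=
  (Matrix.trace (CFC.abs T)).re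

/-- The space `H(n)` of Hermitian matrices. -/
abbrev HermitianMatrix (n : ℕ) : Type := selfAdjoint (Matrix (Fin n) (Fin n) ℂ)

/-- The set `U(n)` of unitary matrices. -/
def unitaryMatrices (n : ℕ) : Set (Matrix (Fin n) (Fin n) ℂ) :=
  {U | U ∈ Matrix.unitaryGroup (Fin n) ℂ}

/-- The `j`-th eigenvalue `λ_j(A)` of a Hermitian matrix, the eigenvalues being counted with
multiplicity and arranged in non-increasing order. -/
def sortedEigenvalue {n : ℕ} (j : Fin n) (A : HermitianMatrix n) : ℝ :=
  Matrix.IsHermitian.eigenvalues₀ (A := (A : Matrix (Fin n) (Fin n) ℂ)) A.2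
    (Fin.cast (Fintype.card_fin n).symm j)

/-- The matrix `e^{iA}` for a complex square matrix `A`. -/
def expI {n : ℕ} (A : Matrix (Fin n) (Fin n) ℂ) : Matrix (Fin n) (Fin n) ℂ :=
  NormedSpace.exp (Complex.I • A)

/-- A curve parametrized by `[0,1]` is smooth. -/
def IsSmoothCurve {E : Type*} [NormedAddCommGroup E] [NormedSpace ℝ E] (γ : ℝ → E) : Prop :=
  ContDiffOn ℝ ∞ γ (Set.Icc 0 1)

/-- A curve parametrized by `[0,1]` is piecewise smooth: it is continuous, and `[0,1]` has a
finite partition such that the curve is smooth on each of its closed subintervals. -/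
def IsPiecewiseSmoothCurve {E : Type*} [NormedAddCommGroup E] [NormedSpace ℝ E]
    (γ : ℝ → E) : Prop :=
  ContinuousOn γ (Set.Icc 0 1) ∧
    ∃ (m : ℕ) (t : Fin (m + 1) → ℝ), StrictMono t ∧ t 0 = 0 ∧ t (Fin.last m) = 1 ∧
      ∀ i : Fin m, ContDiffOn ℝ ∞ γ (Set.Icc (t i.castSucc) (t i.succ))

/-- The length `∫₀¹ N(γ'(t)) dt` of a curve, measured with a norm `N` on the ambient space. -/
def curveLength {E : Type*} [NormedAddCommGroup E] [NormedSpace ℝ E]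
    (N : E → ℝ) (γ : ℝ → E) : ℝ :=
  ∫ t in (0 : ℝ)..1, N (deriv γ t)

/-- `γ` is a minimal curve in `S` for the norm `N`: it is a piecewise smooth curve in `S`, and no
piecewise smooth curve in `S` with the same endpoints is shorter. -/
def IsMinimalCurve {E : Type*} [NormedAddCommGroup E] [NormedSpace ℝ E]
    (N : E → ℝ) (S : Set E) (γ : ℝ → E) : Prop :=
  IsPiecewiseSmoothCurve γ ∧ (∀ t ∈ Set.Icc (0 : ℝ) 1, γ t ∈ S) ∧
    ∀ β : ℝ → E, IsPiecewiseSmoothCurve β → (∀ t ∈ Set.Icc (0 : ℝ) 1, β t ∈ S) →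
      β 0 = γ 0 → β 1 = γ 1 → curveLength N γ ≤ curveLength N β

/-- `Y` is a smooth curve of Hermitian matrices with `α(t) = e^{iY(t)}` and spectral norm
`‖Y(t)‖ < π` for every `t ∈ [0,1]`. -/
def IsSmoothLog {n : ℕ} (α : ℝ → Matrix (Fin n) (Fin n) ℂ) (Y : ℝ → HermitianMatrix n) : Prop :=
  IsSmoothCurve (fun t => (Y t : Matrix (Fin n) (Fin n) ℂ)) ∧
    ∀ t ∈ Set.Icc (0 : ℝ) 1,
      α t = expI (Y t : Matrix (Fin n) (Fin n) ℂ) ∧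
        ‖(Y t : Matrix (Fin n) (Fin n) ℂ)‖ < Real.pi

/-- The eigenvalue curve `t ↦ e^{i λ_j(Y(t))}` in the circle. -/
def eigenvalueCurve {n : ℕ} (Y : ℝ → HermitianMatrix n) (j : Fin n) : ℝ → ℂ :=
  fun t => Complex.exp (Complex.I * (sortedEigenvalue j (Y t) : ℂ))

end

/-! The proof is a Kantorovich-type duality. Let `g` be a potential on angles that is 1-Lipschitz
for the circle distance. Along a curve of unitaries, the sum of `g` over the eigenvalue angles
increases by at most the trace-norm length (`sum_sub_sum_le_integral_traceNorm`). No perturbation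
theory of eigenvalues enters. If `W` and `Z` diagonalize two unitaries `U` and `V`, the squared
entries of `W* Z` form a doubly stochastic matrix coupling the two spectra. For a semiconcave `g`
this bounds the increment by the pairing of `V - U` with a contraction, up to a quadratic error that
vanishes under subdivision. General potentials are limits of semiconcave ones. Diagonalizations may
be chosen independently at each time.

The distance to `0`, taken as potential, gives the lower bound `∑ |λ_j(X)|` for the length from `I`
to `e^{iX}`, and `e^{itX}` attains it. A minimal curve is therefore tight on every subinterval: its
length there is the increment of `∑ |λ_j|`. Other potentials exploit this tightness. Truncating the
distance at `r = ‖X‖` confines the spectrum to `[-r, r]`, away from the cut at `-1`, so the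
principal logarithm is smooth. Subtracting from `|x|` a thin layer `min (max (± x - c) 0) ε` shows
that the sum of these layers never decreases. Comparing layers level by level, the positive and
negative parts of each ordered eigenvalue are non-decreasing in time. The sign of `λ_j(X)` decides
which part is present, hence `λ_j` is monotone. Its length is then `|λ_j(X)|`, the least possible on
the line and, since `|λ_j(X)| < π`, on the circle. -/

/-! ### Circle distance and semiconcave potentials -/

/-- The distance of the angle `x` to `0` on the circle. -/
noncomputable def circleDist (x : ℝ) : ℝ := Real.arccos (Real.cos x)

/-- A smoothing (for `s < 1`) of the circle distance. -/
noncomputable def smoothCircleDist (s x : ℝ) : ℝ := Real.arccos (s * Real.cos x)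

lemma circleDist_eq_abs {x : ℝ} (hx : |x| ≤ Real.pi) : circleDist x = |x| := by
  rw [circleDist, ← Real.cos_abs, Real.arccos_cos (abs_nonneg x) hx]

lemma circleDist_le_abs (x : ℝ) : circleDist x ≤ |x| := by
  rcases le_total |x| Real.pi with h | h
  · exact (circleDist_eq_abs h).le
  · exact (Real.arccos_le_pi _).trans h

lemma exists_circleDist_eq_abs_sub (x : ℝ) :
    ∃ k : ℤ, circleDist x = |x - k * (2 * Real.pi)| := by
  refine ⟨toIocDiv Real.two_pi_pos (-Real.pi) x, ?_⟩
  have h := toIocMod_mem_Ioc Real.two_pi_pos (-Real.pi) x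
  rw [toIocMod, zsmul_eq_mul] at h
  rw [← circleDist_eq_abs (abs_le.2 ⟨h.1.le, by linarith [h.2]⟩), circleDist, circleDist,
    Real.cos_sub_int_mul_two_pi]

lemma circleDist_add_le (x y : ℝ) : circleDist (x + y) ≤ circleDist x + circleDist y := by
  obtain ⟨k, hk⟩ := exists_circleDist_eq_abs_sub x
  obtain ⟨l, hl⟩ := exists_circleDist_eq_abs_sub y
  calc circleDist (x + y)
      = circleDist ((x - k * (2 * Real.pi)) + (y - l * (2 * Real.pi))) := by
        have : (x - k * (2 * Real.pi)) + (y - l * (2 * Real.pi))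
          = x + y - ((k + l : ℤ) : ℝ) * (2 * Real.pi) := by push_cast; ring
        rw [this, circleDist, circleDist, Real.cos_sub_int_mul_two_pi]
    _ ≤ _ := circleDist_le_abs _
    _ ≤ _ := abs_add_le _ _
    _ = _ := by rw [hk, hl]

lemma circleDist_sub_le (x y : ℝ) : circleDist x - circleDist y ≤ circleDist (x - y) := by
  have := circleDist_add_le (x - y) y
  rw [sub_add_cancel] at this
  linarith

/-- A first order expansion of `y ↦ arccos (s y)` with uniform quadratic error. -/
lemma exists_arccos_taylor {s : ℝ} (hs0 : 0 ≤ s) (hs : s < 1) :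
    ∃ C : ℝ, 0 ≤ C ∧ ∀ y ∈ Set.Icc (-1 : ℝ) 1, ∀ z ∈ Set.Icc (-1 : ℝ) 1,
      Real.arccos (s * z) - Real.arccos (s * y) ≤
        -(s / √(1 - (s * y) ^ 2)) * (z - y) + C * (z - y) ^ 2 := by
  -- Since `s < 1`, the argument `s * y` stays off `±1`, where `arccos` is not differentiable.
  have hy1 : ∀ y ∈ Set.Icc (-1 : ℝ) 1, 0 < 1 - (s * y) ^ 2 := by
    intro y hy
    have : |s * y| < 1 := by
      rw [abs_mul, abs_of_nonneg hs0]
      have := abs_le.2 ⟨hy.1, hy.2⟩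
      nlinarith [abs_nonneg y]
    nlinarith [sq_abs (s * y), abs_nonneg (s * y)]
  have hd : ∀ y ∈ Set.Icc (-1 : ℝ) 1,
      HasDerivAt (fun y => Real.arccos (s * y)) (-(s / √(1 - (s * y) ^ 2))) y := by
    intro y hy
    have h := hy1 y hy
    have h2 := (Real.hasDerivAt_arccos (x := s * y) (by intro h'; rw [h'] at h; norm_num at h)
      (by intro h'; rw [h'] at h; norm_num at h)).comp y ((hasDerivAt_id y).const_mul s)
    refine h2.congr_deriv ?_
    rw [mul_one, neg_mul, mul_comm (1 / _), mul_one_div]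
  have hc : ContDiffOn ℝ 1 (fun y : ℝ => -(s / √(1 - (s * y) ^ 2))) (Set.Icc (-1) 1) := by
    refine (ContDiffOn.div contDiffOn_const ?_ ?_).neg
    · refine ContDiffOn.sqrt ?_ (fun y hy => (hy1 y hy).ne')
      exact (by fun_prop : ContDiff ℝ 1 (fun y : ℝ => 1 - (s * y) ^ 2)).contDiffOn
    · exact fun y hy => (Real.sqrt_pos.2 (hy1 y hy)).ne'
  -- The constant `C` is a Lipschitz constant of the derivative; the mean value theorem then gives
  -- the quadratic remainder.
  obtain ⟨K, hK⟩ := hc.exists_lipschitzOnWith one_ne_zero (convex_Icc (-1 : ℝ) 1) isCompact_Icc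
  refine ⟨K, K.2, fun y hy z hz => ?_⟩
  have hsub : Set.uIcc y z ⊆ Set.Icc (-1 : ℝ) 1 := Set.uIcc_subset_Icc hy hz
  obtain ⟨ξ, hξ, hξ'⟩ : ∃ ξ ∈ Set.uIcc y z, Real.arccos (s * z) - Real.arccos (s * y)
      = -(s / √(1 - (s * ξ) ^ 2)) * (z - y) := by
    rcases lt_trichotomy y z with h | h | h
    · obtain ⟨ξ, hξ, h'⟩ := exists_hasDerivAt_eq_slope (fun y => Real.arccos (s * y)) _ h
        (by fun_prop) (fun x hx => hd x (hsub (by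
          rw [Set.uIcc_of_le h.le]; exact Set.Ioo_subset_Icc_self hx)))
      refine ⟨ξ, by rw [Set.uIcc_of_le h.le]; exact Set.Ioo_subset_Icc_self hξ, ?_⟩
      rw [h', div_mul_cancel₀ _ (sub_pos.2 h).ne']
    · exact ⟨y, by simp, by simp [h]⟩
    · obtain ⟨ξ, hξ, h'⟩ := exists_hasDerivAt_eq_slope (fun y => Real.arccos (s * y)) _ h
        (by fun_prop) (fun x hx => hd x (hsub (by
          rw [Set.uIcc_of_ge h.le]; exact Set.Ioo_subset_Icc_self hx)))
      refine ⟨ξ, by rw [Set.uIcc_of_ge h.le]; exact Set.Ioo_subset_Icc_self hξ, ?_⟩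
      rw [h', ← neg_sub y z, mul_neg, div_mul_cancel₀ _ (sub_pos.2 h).ne', neg_sub]
  rw [hξ']
  have h1 := hK.dist_le_mul ξ (hsub hξ) y hy
  rw [Real.dist_eq, Real.dist_eq] at h1
  have h2 : |ξ - y| ≤ |z - y| := by
    exact Set.abs_sub_left_of_mem_uIcc hξ
  have h3 : (-(s / √(1 - (s * ξ) ^ 2)) - -(s / √(1 - (s * y) ^ 2))) * (z - y) ≤
      K * (z - y) ^ 2 := by
    refine (le_abs_self _).trans ?_
    rw [abs_mul, ← sq_abs (z - y), sq |z - y|, ← mul_assoc]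
    exact mul_le_mul_of_nonneg_right (h1.trans (mul_le_mul_of_nonneg_left h2 K.2)) (abs_nonneg _)
  linarith

/-- The semiconcavity estimate satisfied by the smoothed circle distance. -/
lemma exists_smoothCircleDist_sub_le {s : ℝ} (hs0 : 0 ≤ s) (hs : s < 1) :
    ∃ C : ℝ, 0 ≤ C ∧ ∀ a : ℝ, ∃ φ : ℝ, |φ| ≤ 1 ∧ ∀ b : ℝ,
      smoothCircleDist s b - smoothCircleDist s a ≤
        φ * Real.sin (b - a) + C * (1 - Real.cos (b - a)) := by
  obtain ⟨C, hC0, hC⟩ := exists_arccos_taylor hs0 hs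
  have hs2 : 0 < 1 - s ^ 2 := by nlinarith
  -- The first summand absorbs the `cos a * (1 - cos (b - a))` part of the linear term. The second
  -- comes from `(cos b - cos a) ^ 2 ≤ 2 * (1 - cos (b - a))`.
  refine ⟨s / √(1 - s ^ 2) + 2 * C, by positivity, fun a => ?_⟩
  have hq : 1 - s ^ 2 ≤ 1 - (s * Real.cos a) ^ 2 := by
    rw [mul_pow]; nlinarith [Real.cos_sq_le_one a, sq_nonneg s]
  have hq' : 0 < √(1 - (s * Real.cos a) ^ 2) := Real.sqrt_pos.2 (hs2.trans_le hq)
  -- The slope is the derivative of `smoothCircleDist s` at `a`.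
  refine ⟨s * Real.sin a / √(1 - (s * Real.cos a) ^ 2), ?_, fun b => ?_⟩
  · rw [abs_div, abs_of_pos hq', div_le_one hq']
    refine Real.abs_le_sqrt ?_
    nlinarith [Real.sin_sq_add_cos_sq a, sq_nonneg s, mul_pow s (Real.sin a) 2,
      mul_pow s (Real.cos a) 2]
  · have h := hC (Real.cos a) ⟨Real.neg_one_le_cos a, Real.cos_le_one a⟩ (Real.cos b)
      ⟨Real.neg_one_le_cos b, Real.cos_le_one b⟩
    have e1 : Real.cos b - Real.cos a =
        -(Real.sin a * Real.sin (b - a)) - Real.cos a * (1 - Real.cos (b - a)) := by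
      have : Real.cos b = Real.cos (a + (b - a)) := by ring_nf
      rw [this, Real.cos_add]; ring
    have h0 : 0 ≤ 1 - Real.cos (b - a) := by linarith [Real.cos_le_one (b - a)]
    have e2 : (Real.cos b - Real.cos a) ^ 2 ≤ 2 * (1 - Real.cos (b - a)) := by
      rw [Real.cos_sub]
      nlinarith [Real.sin_sq_add_cos_sq a, Real.sin_sq_add_cos_sq b,
        sq_nonneg (Real.sin b - Real.sin a)]
    set D := s / √(1 - (s * Real.cos a) ^ 2) with hD
    have hD0 : 0 ≤ D := by positivity
    have hD1 : D ≤ s / √(1 - s ^ 2) := by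
      have := Real.sqrt_pos.2 hs2
      rw [hD]; gcongr
    have e3 : s * Real.sin a / √(1 - (s * Real.cos a) ^ 2) = D * Real.sin a := by rw [hD]; ring
    rw [e3]
    simp only [smoothCircleDist]
    have h4 : D * (Real.cos a * (1 - Real.cos (b - a))) ≤
        s / √(1 - s ^ 2) * (1 - Real.cos (b - a)) := by
      refine (mul_le_mul_of_nonneg_left ?_ hD0).trans (mul_le_mul_of_nonneg_right hD1 h0)
      exact mul_le_of_le_one_left h0 (Real.cos_le_one a)
    have h5 := mul_le_mul_of_nonneg_left e2 hC0
    rw [e1] at h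
    rw [e1] at h5
    nlinarith

/-- Every potential that is `1`-Lipschitz for the circle distance is a limit of semiconcave
potentials `x ↦ min_c (g c + smoothCircleDist s (x - c))`. -/
lemma exists_inf'_smoothCircleDist_sub_le {P : Finset ℝ} (hP : P.Nonempty) (g : ℝ → ℝ) {s : ℝ}
    (hs0 : 0 ≤ s) (hs : s < 1) :
    ∃ C : ℝ, 0 ≤ C ∧ ∀ a : ℝ, ∃ φ : ℝ, |φ| ≤ 1 ∧ ∀ b : ℝ,
      P.inf' hP (fun c => g c + smoothCircleDist s (b - c)) -
        P.inf' hP (fun c => g c + smoothCircleDist s (a - c)) ≤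
        φ * Real.sin (b - a) + C * (1 - Real.cos (b - a)) := by
  obtain ⟨C, hC0, hC⟩ := exists_smoothCircleDist_sub_le hs0 hs
  refine ⟨C, hC0, fun a => ?_⟩
  obtain ⟨c, hc, hca⟩ := P.exists_mem_eq_inf' hP (fun c => g c + smoothCircleDist s (a - c))
  obtain ⟨φ, hφ, h⟩ := hC (a - c)
  refine ⟨φ, hφ, fun b => ?_⟩
  have h1 := h (b - c)
  rw [sub_sub_sub_cancel_right] at h1
  have h2 := P.inf'_le (fun c => g c + smoothCircleDist s (b - c)) hc
  rw [hca]
  linarith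

/-- McShane's formula: at `s = 1` the term `c = x` equals `g x`, and the Lipschitz bound makes every
other term at least as large. A finite minimum of functions continuous in `s` is continuous. -/
lemma tendsto_inf'_smoothCircleDist {P : Finset ℝ} (hP : P.Nonempty) (g : ℝ → ℝ)
    (hg : ∀ x ∈ P, ∀ y ∈ P, g x - g y ≤ circleDist (x - y)) {x : ℝ} (hx : x ∈ P) :
    Filter.Tendsto (fun s => P.inf' hP (fun c => g c + smoothCircleDist s (x - c)))
      (nhdsWithin 1 (Set.Ico 0 1)) (nhds (g x)) := by
  have h1 : P.inf' hP (fun c => g c + smoothCircleDist 1 (x - c)) = g x := by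
    refine le_antisymm ((P.inf'_le _ hx).trans_eq ?_) (P.le_inf' _ _ fun c hc => ?_)
    · simp [smoothCircleDist]
    · have := hg x hx c hc
      rw [circleDist] at this
      rw [smoothCircleDist, one_mul]
      linarith
  rw [← h1]
  refine tendsto_nhdsWithin_of_tendsto_nhds (Continuous.tendsto ?_ 1)
  refine Continuous.finset_inf'_apply hP fun c _ => ?_
  simp only [smoothCircleDist]
  fun_prop

lemma Fin.exists_castSucc_le_lt_succ {m : ℕ} {t : Fin (m + 1) → ℝ} {x : ℝ} (h0 : t 0 ≤ x)
    (h1 : x < t (Fin.last m)) : ∃ i : Fin m, t i.castSucc ≤ x ∧ x < t i.succ := by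
  by_contra! h
  have : ∀ i : Fin (m + 1), t i ≤ x := fun i => Fin.induction h0 (fun i hi => h i hi) i
  exact absurd (this (Fin.last m)) (not_le.2 h1)

/-! ### Piecewise smooth curves and length estimates -/

section Curves

variable {E : Type*} [NormedAddCommGroup E] [NormedSpace ℝ E]

lemma IsSmoothCurve.isPiecewiseSmoothCurve {γ : ℝ → E} (h : IsSmoothCurve γ) :
    IsPiecewiseSmoothCurve γ := by
  refine ⟨h.continuousOn, 1, ![0, 1], ?_, rfl, rfl, fun i => ?_⟩
  · rw [Fin.strictMono_iff_lt_succ]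
    intro i
    fin_cases i
    simp
  · fin_cases i
    simpa using (show ContDiffOn ℝ ∞ γ (Set.Icc 0 1) from h)

/-- Replaces the partition by a finite, hence null, exceptional set. It contains `0` and `1`, where
`deriv` depends on values outside the interval. The bound holds because the one-sided derivatives
are continuous on each compact piece. -/
lemma IsPiecewiseSmoothCurve.exists_finset_contDiffAt {γ : ℝ → E}
    (h : IsPiecewiseSmoothCurve γ) :
    ∃ (T : Finset ℝ) (K : ℝ), ∀ x ∈ Set.Icc (0 : ℝ) 1, x ∉ T →
      ContDiffAt ℝ ∞ γ x ∧ ‖deriv γ x‖ ≤ K := by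
  classical
  obtain ⟨-, m, t, ht, h0, h1, hs⟩ := h
  have hK : ∀ i : Fin m, ∃ K : ℝ, 0 ≤ K ∧ ∀ x ∈ Set.Icc (t i.castSucc) (t i.succ),
      ‖derivWithin γ (Set.Icc (t i.castSucc) (t i.succ)) x‖ ≤ K := by
    intro i
    have hc : ContinuousOn (derivWithin γ (Set.Icc (t i.castSucc) (t i.succ)))
        (Set.Icc (t i.castSucc) (t i.succ)) :=
      (hs i).continuousOn_derivWithin (uniqueDiffOn_Icc (ht Fin.castSucc_lt_succ)) (by simp)
    obtain ⟨K, hK⟩ := isCompact_Icc.exists_bound_of_continuousOn hc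
    exact ⟨max K 0, le_max_right _ _, fun x hx => (hK x hx).trans (le_max_left _ _)⟩
  choose K hK0 hK using hK
  refine ⟨Finset.univ.image t, ∑ i, K i, fun x hx hxT => ?_⟩
  have hne : ∀ i, t i ≠ x := fun i hi => hxT (Finset.mem_image.2 ⟨i, Finset.mem_univ i, hi⟩)
  obtain ⟨i, hi1, hi2⟩ := Fin.exists_castSucc_le_lt_succ (t := t) (x := x) (h0 ▸ hx.1)
    (lt_of_le_of_ne (h1 ▸ hx.2) (hne _).symm)
  have hi1' := lt_of_le_of_ne hi1 (hne _)
  have hnhds : Set.Icc (t i.castSucc) (t i.succ) ∈ nhds x := Icc_mem_nhds hi1' hi2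
  refine ⟨(hs i).contDiffAt hnhds, ?_⟩
  rw [← derivWithin_of_mem_nhds hnhds]
  exact (hK i x ⟨hi1, hi2.le⟩).trans
    (Finset.single_le_sum (f := K) (fun i _ => hK0 i) (Finset.mem_univ i))

lemma IsPiecewiseSmoothCurve.intervalIntegrable_comp_deriv [ProperSpace E]
    {γ : ℝ → E} (h : IsPiecewiseSmoothCurve γ) {G : Type*} [NormedAddCommGroup G] {N : E → G}
    (hN : Continuous N) {u v : ℝ}
    (hu : u ∈ Set.Icc (0 : ℝ) 1) (hv : v ∈ Set.Icc (0 : ℝ) 1) :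
    IntervalIntegrable (fun t => N (deriv γ t)) MeasureTheory.volume u v := by
  obtain ⟨T, K, hT⟩ := h.exists_finset_contDiffAt
  obtain ⟨M, hM⟩ := (isCompact_closedBall (0 : E) K).exists_bound_of_continuousOn hN.continuousOn
  refine (intervalIntegrable_const (c := M)).mono_fun'
    (hN.comp_stronglyMeasurable (stronglyMeasurable_deriv γ)).aestronglyMeasurable ?_
  have h0 : ∀ᵐ t : ℝ, t ∉ (T : Set ℝ) :=
    MeasureTheory.measure_eq_zero_iff_ae_notMem.1 (T.finite_toSet.measure_zero _)
  filter_upwards [MeasureTheory.ae_restrict_of_ae h0,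
    MeasureTheory.ae_restrict_mem measurableSet_uIoc] with t ht ht'
  have := Set.uIcc_subset_Icc hu hv (Set.uIoc_subset_uIcc ht')
  exact hM _ (by simpa using (hT t this ht).2)

lemma IsPiecewiseSmoothCurve.integral_clm_deriv_eq_sub [ProperSpace E]
    {γ : ℝ → E} (h : IsPiecewiseSmoothCurve γ) {u v : ℝ}
    (hu : u ∈ Set.Icc (0 : ℝ) 1) (hv : v ∈ Set.Icc (0 : ℝ) 1) (ψ : E →L[ℝ] ℝ) :
    ∫ t in u..v, ψ (deriv γ t) = ψ (γ v - γ u) := by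
  obtain ⟨T, K, hT⟩ := h.exists_finset_contDiffAt
  have hsub := Set.uIcc_subset_Icc hu hv
  rw [map_sub]
  refine MeasureTheory.integral_eq_of_hasDerivAt_off_countable (fun t => ψ (γ t)) _
    (T.countable_toSet) (ψ.continuous.comp_continuousOn (h.1.mono hsub)) (fun x hx => ?_)
    (h.intervalIntegrable_comp_deriv ψ.continuous hu hv)
  have hd := ((hT x (hsub (Set.Ioo_subset_Icc_self hx.1)) hx.2).1.differentiableAt
    (by simp)).hasDerivAt
  exact ψ.hasFDerivAt.comp_hasDerivAt x hd

/-- Turns errors quadratic in the increment of the curve into errors quadratic in time. -/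
lemma IsPiecewiseSmoothCurve.exists_norm_sub_le [ProperSpace E]
    {γ : ℝ → E} (h : IsPiecewiseSmoothCurve γ) :
    ∃ K : ℝ, 0 ≤ K ∧ ∀ u ∈ Set.Icc (0 : ℝ) 1, ∀ v ∈ Set.Icc (0 : ℝ) 1,
      ‖γ v - γ u‖ ≤ K * |v - u| := by
  have : CompleteSpace E := inferInstance
  obtain ⟨T, K, hT⟩ := h.exists_finset_contDiffAt
  refine ⟨max K 0, le_max_right _ _, fun u hu v hv => ?_⟩
  have hsub := Set.uIcc_subset_Icc hu hv
  rw [← MeasureTheory.integral_eq_of_hasDerivAt_off_countable γ (deriv γ)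
    (T.countable_toSet) (h.1.mono hsub) (fun x hx => ((hT x
      (hsub (Set.Ioo_subset_Icc_self hx.1)) hx.2).1.differentiableAt (by simp)).hasDerivAt)
    (h.intervalIntegrable_comp_deriv (N := id) continuous_id hu hv)]
  refine intervalIntegral.norm_integral_le_of_norm_le_const_ae ?_
  have h0 : ∀ᵐ t : ℝ, t ∉ (T : Set ℝ) :=
    MeasureTheory.measure_eq_zero_iff_ae_notMem.1 (T.finite_toSet.measure_zero _)
  filter_upwards [h0] with t ht ht'
  exact (hT t (hsub (Set.uIoc_subset_uIcc ht')) ht).2.trans (le_max_left _ _)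

/-- A quadratic error in an increment estimate disappears under subdivision. -/
lemma sub_le_sub_of_quadratic_error {F l : ℝ → ℝ} {C a b : ℝ} (hab : a ≤ b)
    (h : ∀ u ∈ Set.Icc a b, ∀ v ∈ Set.Icc a b, u ≤ v →
      F v - F u ≤ l v - l u + C * (v - u) ^ 2) :
    F b - F a ≤ l b - l a := by
  -- With `m + 1` equal steps the accumulated error is `C (b - a)² / (m + 1)`.
  have key : ∀ m : ℕ, F b - F a ≤ l b - l a + C * (b - a) ^ 2 * (1 / ((m : ℝ) + 1)) := by
    intro m
    have hm : (0 : ℝ) < m + 1 := by positivity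
    set x : ℕ → ℝ := fun k => a + (b - a) * (k / ((m : ℝ) + 1)) with hx
    have hx0 : x 0 = a := by simp [hx]
    have hx1 : x (m + 1) = b := by
      simp only [hx]; push_cast; rw [div_self hm.ne']; ring
    have hstep : ∀ k, x (k + 1) - x k = (b - a) * (1 / ((m : ℝ) + 1)) := by
      intro k; simp only [hx]; push_cast; ring
    have hmem : ∀ k ≤ m + 1, x k ∈ Set.Icc a b := by
      intro k hk
      have h1 : (k : ℝ) / (m + 1) ≤ 1 := by
        rw [div_le_one hm]; exact_mod_cast hk
      have h0 : (0 : ℝ) ≤ k / (m + 1) := by positivity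
      constructor <;> simp only [hx] <;> nlinarith
    have hsum : ∑ k ∈ Finset.range (m + 1), (F (x (k + 1)) - F (x k)) ≤
        ∑ k ∈ Finset.range (m + 1),
          ((l (x (k + 1)) - l (x k)) + C * ((b - a) * (1 / ((m : ℝ) + 1))) ^ 2) := by
      refine Finset.sum_le_sum fun k hk => ?_
      have hk' := Finset.mem_range.1 hk
      rw [← hstep k]
      refine h _ (hmem k hk'.le) _ (hmem (k + 1) hk') ?_
      have : 0 ≤ x (k + 1) - x k := by
        rw [hstep]
        exact mul_nonneg (sub_nonneg.2 hab) (by positivity)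
      linarith
    rw [Finset.sum_add_distrib, Finset.sum_range_sub (fun k => F (x k)),
      Finset.sum_range_sub (fun k => l (x k)), hx0, hx1, Finset.sum_const,
      Finset.card_range, nsmul_eq_mul] at hsum
    refine hsum.trans_eq ?_
    push_cast
    field_simp
  have hlim : Filter.Tendsto
      (fun m : ℕ => l b - l a + C * (b - a) ^ 2 * (1 / ((m : ℝ) + 1))) Filter.atTop
      (nhds (l b - l a + C * (b - a) ^ 2 * 0)) :=
    (tendsto_one_div_add_atTop_nhds_zero_nat.const_mul _).const_add _
  rw [mul_zero, add_zero] at hlim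
  exact ge_of_tendsto' hlim key

/-- Increments of a function which is semiconcave along a curve, with slopes dominated by `N`,
are bounded by the `N`-length. -/
lemma IsPiecewiseSmoothCurve.sub_le_integral [ProperSpace E] {γ : ℝ → E}
    (hγ : IsPiecewiseSmoothCurve γ) {N : E → ℝ} (hN : Continuous N) {F : ℝ → ℝ} {C : ℝ}
    (hC : 0 ≤ C)
    (h : ∀ u ∈ Set.Icc (0 : ℝ) 1, ∀ v ∈ Set.Icc (0 : ℝ) 1, ∃ ψ : E →L[ℝ] ℝ,
      (∀ x, ψ x ≤ N x) ∧ F v - F u ≤ ψ (γ v - γ u) + C * ‖γ v - γ u‖ ^ 2)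
    {a b : ℝ} (ha : a ∈ Set.Icc (0 : ℝ) 1) (hb : b ∈ Set.Icc (0 : ℝ) 1) (hab : a ≤ b) :
    F b - F a ≤ ∫ t in a..b, N (deriv γ t) := by
  obtain ⟨K, hK0, hK⟩ := hγ.exists_norm_sub_le
  have hsub : Set.Icc a b ⊆ Set.Icc (0 : ℝ) 1 := Set.Icc_subset_Icc ha.1 hb.2
  have := sub_le_sub_of_quadratic_error (F := F) (l := fun t => ∫ r in a..t, N (deriv γ r))
    (C := C * K ^ 2) hab ?_
  · simpa using this
  intro u hu v hv huv
  obtain ⟨ψ, hψ, hF⟩ := h u (hsub hu) v (hsub hv)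
  have h1 : ψ (γ v - γ u) ≤ ∫ t in u..v, N (deriv γ t) := by
    rw [← hγ.integral_clm_deriv_eq_sub (hsub hu) (hsub hv)]
    exact intervalIntegral.integral_mono_on huv
      (hγ.intervalIntegrable_comp_deriv ψ.continuous (hsub hu) (hsub hv))
      (hγ.intervalIntegrable_comp_deriv hN (hsub hu) (hsub hv)) (fun t _ => hψ _)
  have h2 : ‖γ v - γ u‖ ^ 2 ≤ K ^ 2 * (v - u) ^ 2 := by
    rw [← sq_abs (v - u), ← mul_pow]
    exact pow_le_pow_left₀ (norm_nonneg _) (hK u (hsub hu) v (hsub hv)) 2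
  rw [intervalIntegral.integral_interval_sub_left
    (hγ.intervalIntegrable_comp_deriv hN ha (hsub hv))
    (hγ.intervalIntegrable_comp_deriv hN ha (hsub hu))]
  nlinarith

end Curves

/-! ### Trace norm and its duality with the spectral norm -/

section TraceNorm

variable {n : ℕ}

lemma properSpace_matrix : ProperSpace (Matrix (Fin n) (Fin n) ℂ) :=
  FiniteDimensional.proper ℂ _

lemma continuous_traceNorm : Continuous (traceNorm (n := n)) :=
  Complex.continuous_re.comp (Continuous.matrix_trace CFC.continuous_abs)

lemma norm_mul_apply_le (A B : Matrix (Fin n) (Fin n) ℂ) (k l : Fin n) :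
    ‖(A * B) k l‖ ≤ ‖A‖ * ‖WithLp.toLp 2 (fun i => B i l)‖ := by
  have h := Matrix.l2_opNorm_mulVec A (WithLp.toLp 2 (fun i => B i l))
  refine le_trans ?_ h
  exact PiLp.norm_apply_le (WithLp.toLp 2 (A.mulVec fun i => B i l)) k

lemma norm_apply_le_l2_opNorm (A : Matrix (Fin n) (Fin n) ℂ) (k l : Fin n) : ‖A k l‖ ≤ ‖A‖ := by
  have h := norm_mul_apply_le A 1 k l
  rw [mul_one] at h
  refine h.trans_eq ?_
  have : (fun i => (1 : Matrix (Fin n) (Fin n) ℂ) i l) = Pi.single l 1 := by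
    ext i; simp [Matrix.one_apply, Pi.single_apply]
  rw [this]
  simp

lemma norm_toLp_col_sq (B : Matrix (Fin n) (Fin n) ℂ) (l : Fin n) :
    ‖WithLp.toLp 2 (fun i => B i l)‖ ^ 2 = ((star B * B) l l).re := by
  rw [EuclideanSpace.norm_sq_eq, Matrix.mul_apply, Complex.re_sum]
  refine Finset.sum_congr rfl fun i _ => ?_
  rw [Matrix.star_apply, RCLike.star_def, Complex.conj_mul']
  norm_cast

lemma norm_le_one_of_mem_unitaryGroup {W : Matrix (Fin n) (Fin n) ℂ}
    (hW : W ∈ Matrix.unitaryGroup (Fin n) ℂ) : ‖W‖ ≤ 1 := by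
  have h : ‖W‖ * ‖W‖ ≤ 1 := by
    rw [← CStarRing.norm_star_mul_self, Unitary.star_mul_self_of_mem hW, ← Matrix.diagonal_one,
      Matrix.l2_opNorm_diagonal, pi_norm_le_iff_of_nonneg zero_le_one]
    simp
  nlinarith [norm_nonneg W]

lemma diagonal_exp_mem_unitaryGroup (a : Fin n → ℝ) :
    Matrix.diagonal (fun j => Complex.exp (Complex.I * a j)) ∈ Matrix.unitaryGroup (Fin n) ℂ := by
  rw [Matrix.mem_unitaryGroup_iff', Matrix.star_eq_conjTranspose, Matrix.diagonal_conjTranspose,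
    Matrix.diagonal_mul_diagonal, ← Matrix.diagonal_one]
  congr 1
  ext j
  rw [Pi.star_apply, RCLike.star_def, Complex.conj_mul', mul_comm Complex.I,
    Complex.norm_exp_ofReal_mul_I]
  simp

lemma exists_eq_conj_diagonal {A : Matrix (Fin n) (Fin n) ℂ} (hA : A.IsHermitian) :
    ∃ W ∈ Matrix.unitaryGroup (Fin n) ℂ, ∀ f : ℝ → ℝ,
      cfc f A = W * Matrix.diagonal (fun j => ((f (hA.eigenvalues j) : ℝ) : ℂ)) * star W := by
  refine ⟨_, hA.eigenvectorUnitary.2, fun f => ?_⟩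
  rw [hA.cfc_eq, Matrix.IsHermitian.cfc, Unitary.conjStarAlgAut_apply]
  rfl

open scoped ComplexOrder in
/-- The trace norm dominates the pairing with any contraction. -/
lemma re_trace_mul_le_traceNorm {Φ : Matrix (Fin n) (Fin n) ℂ} (hΦ : ‖Φ‖ ≤ 1)
    (T : Matrix (Fin n) (Fin n) ℂ) : (Matrix.trace (Φ * T)).re ≤ traceNorm T := by
  have hP : 0 ≤ CFC.abs T := CFC.abs_nonneg T
  have hsa : IsSelfAdjoint (CFC.abs T) := hP.isSelfAdjoint
  have hpos : (CFC.abs T).PosSemidef := Matrix.nonneg_iff_posSemidef.1 hP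
  have hher : (CFC.abs T).IsHermitian := hpos.1
  obtain ⟨W, hW, hf⟩ := exists_eq_conj_diagonal hher
  have h1 := hf id
  rw [cfc_id ℝ (CFC.abs T) hsa] at h1
  have hWW : star W * W = 1 := Unitary.star_mul_self_of_mem hW
  have hWW' : W * star W = 1 := Unitary.mul_star_self_of_mem hW
  have htr : traceNorm T = ∑ k, hher.eigenvalues k := by
    rw [traceNorm, hher.trace_eq_sum_eigenvalues, Complex.re_sum]
    rfl
  -- In an eigenbasis `W` of `|T|`, column `k` of `T * W` has norm equal to the `k`-th eigenvalue of
  -- `|T|`, because `(TW)*(TW) = W*|T|²W`. This replaces a polar decomposition.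
  have htr2 : Matrix.trace (Φ * T) = Matrix.trace ((star W * Φ) * (T * W)) := by
    rw [mul_assoc, Matrix.trace_mul_comm (star W)]
    rw [mul_assoc, mul_assoc, hWW', mul_one]
  rw [htr, htr2, Matrix.trace, Complex.re_sum]
  refine Finset.sum_le_sum fun k _ => ?_
  refine (Complex.re_le_norm _).trans ?_
  refine (norm_mul_apply_le _ _ k k).trans ?_
  have hn : ‖star W * Φ‖ ≤ 1 := by
    refine (norm_mul_le _ _).trans ?_
    rw [norm_star]
    exact mul_le_one₀ (norm_le_one_of_mem_unitaryGroup hW) (norm_nonneg _) hΦ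
  have hcol : ‖WithLp.toLp 2 (fun i => (T * W) i k)‖ = hher.eigenvalues k := by
    rw [← sq_eq_sq₀ (norm_nonneg _) (hpos.eigenvalues_nonneg k), norm_toLp_col_sq]
    have : star (T * W) * (T * W) =
        Matrix.diagonal (fun j => ((hher.eigenvalues j : ℝ) : ℂ) * (hher.eigenvalues j : ℝ)) := by
      rw [star_mul, mul_assoc, ← mul_assoc (star T), ← CFC.abs_mul_abs]
      set D := Matrix.diagonal (fun j => ((id (hher.eigenvalues j) : ℝ) : ℂ)) with hD
      calc star W * (CFC.abs T * CFC.abs T * W)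
          = star W * (W * D * star W * (W * D * star W) * W) :=
            congrArg (fun M => star W * (M * M * W)) h1
        _ = (star W * W) * D * (star W * W) * D * (star W * W) := by simp only [mul_assoc]
        _ = D * D := by rw [hWW]; simp
        _ = _ := by rw [hD, Matrix.diagonal_mul_diagonal]; rfl
    rw [this, Matrix.diagonal_apply_eq, ← Complex.ofReal_mul, Complex.ofReal_re, sq]
  rw [hcol]
  exact mul_le_of_le_one_left (hpos.eigenvalues_nonneg k) hn

lemma traceNorm_nonneg (T : Matrix (Fin n) (Fin n) ℂ) : 0 ≤ traceNorm T := by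
  have := re_trace_mul_le_traceNorm (n := n) (Φ := 0) (by simp) T
  simpa using this

end TraceNorm

/-! ### Coupling of spectra and the dual potential estimate -/

section Increment

variable {n : ℕ}

/-- The weights are the squared overlaps of the two bases. For unitary `W` and `Z` they form a
doubly stochastic matrix, which serves as the transport plan between the two spectra. -/
lemma trace_conj_diagonal_mul_conj_diagonal (W Z : Matrix (Fin n) (Fin n) ℂ) (p q : Fin n → ℂ) :
    Matrix.trace ((W * Matrix.diagonal p * star W) * (Z * Matrix.diagonal q * star Z)) =
      ∑ j, ∑ k, (‖(star W * Z) j k‖ ^ 2 : ℝ) * (p j * q k) := by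
  have : Matrix.trace ((W * Matrix.diagonal p * star W) * (Z * Matrix.diagonal q * star Z)) =
      Matrix.trace (Matrix.diagonal p * (star W * Z) *
        (Matrix.diagonal q * star (star W * Z))) := by
    rw [mul_assoc W, mul_assoc W, Matrix.trace_mul_comm W]
    simp only [star_mul, star_star, mul_assoc]
  rw [this, Matrix.trace]
  refine Finset.sum_congr rfl fun j _ => ?_
  rw [Matrix.diag_apply, Matrix.mul_apply]
  refine Finset.sum_congr rfl fun k _ => ?_
  rw [Matrix.diagonal_mul, Matrix.diagonal_mul, Matrix.star_apply, RCLike.star_def]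
  have := Complex.mul_conj' ((star W * Z) j k)
  push_cast
  rw [← this]
  ring

lemma sum_norm_sq_row_eq_one {S : Matrix (Fin n) (Fin n) ℂ}
    (hS : S ∈ Matrix.unitaryGroup (Fin n) ℂ) (j : Fin n) : ∑ k, ‖S j k‖ ^ 2 = 1 := by
  have h : (S * star S) j j = (1 : Matrix (Fin n) (Fin n) ℂ) j j := by
    rw [Unitary.mul_star_self_of_mem hS]
  rw [Matrix.mul_apply, Matrix.one_apply_eq] at h
  have h2 : (((∑ k, ‖S j k‖ ^ 2 : ℝ)) : ℂ) = 1 := by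
    rw [← h]
    push_cast
    refine Finset.sum_congr rfl fun k _ => ?_
    rw [Matrix.star_apply, RCLike.star_def, Complex.mul_conj']
  exact_mod_cast h2

lemma sum_norm_sq_col_eq_one {S : Matrix (Fin n) (Fin n) ℂ}
    (hS : S ∈ Matrix.unitaryGroup (Fin n) ℂ) (k : Fin n) : ∑ j, ‖S j k‖ ^ 2 = 1 := by
  have h := sum_norm_sq_row_eq_one (Unitary.star_mem hS) k
  simpa [Matrix.star_apply] using h

/-- The increment of `∑ g` over the angles of a unitary matrix is dominated, up to a quadratic
error, by the pairing of the increment of the matrix with a contraction. -/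
lemma exists_contraction_sum_sub_le {W Z : Matrix (Fin n) (Fin n) ℂ}
    (hW : W ∈ Matrix.unitaryGroup (Fin n) ℂ) (hZ : Z ∈ Matrix.unitaryGroup (Fin n) ℂ)
    {a b : Fin n → ℝ} {U V : Matrix (Fin n) (Fin n) ℂ}
    (hU : U = W * Matrix.diagonal (fun j => Complex.exp (Complex.I * a j)) * star W)
    (hV : V = Z * Matrix.diagonal (fun j => Complex.exp (Complex.I * b j)) * star Z)
    {g : ℝ → ℝ} {C : ℝ} (hC : 0 ≤ C)
    (hg : ∀ x : ℝ, ∃ φ : ℝ, |φ| ≤ 1 ∧ ∀ y : ℝ,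
      g y - g x ≤ φ * Real.sin (y - x) + C * (1 - Real.cos (y - x))) :
    ∃ Φ : Matrix (Fin n) (Fin n) ℂ, ‖Φ‖ ≤ 1 ∧
      ∑ k, g (b k) - ∑ j, g (a j) ≤
        (Matrix.trace (Φ * (V - U))).re + C * n * ‖V - U‖ ^ 2 := by
  choose φ hφ hφg using hg
  have hexp : ∀ x y : ℝ, Complex.exp (-(Complex.I * x)) * Complex.exp (Complex.I * y) =
      Real.cos (y - x) + Real.sin (y - x) * Complex.I := by
    intro x y
    rw [← Complex.exp_add, Complex.ofReal_cos, Complex.ofReal_sin, ← Complex.exp_mul_I]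
    congr 1
    push_cast
    ring
  set S := star W * Z with hS
  have hSu : S ∈ Matrix.unitaryGroup (Fin n) ℂ := mul_mem (Unitary.star_mem hW) hZ
  -- The phase is chosen so that pairing with `e^{ib_k}` has real part `φ(a_j) sin(b_k - a_j)`. In
  -- particular the pairing with `U` has real part zero.
  set Φ := W * Matrix.diagonal
    (fun j => -Complex.I * φ (a j) * Complex.exp (-(Complex.I * a j))) * star W with hΦ
  have hΦ1 : ‖Φ‖ ≤ 1 := by
    refine (norm_mul_le _ _).trans (mul_le_one₀ ((norm_mul_le _ _).trans
      (mul_le_one₀ (norm_le_one_of_mem_unitaryGroup hW) (norm_nonneg _) ?_)) (norm_nonneg _) ?_)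
    · rw [Matrix.l2_opNorm_diagonal, pi_norm_le_iff_of_nonneg zero_le_one]
      intro j
      have : Complex.exp (-(Complex.I * a j)) = Complex.exp ((-a j : ℝ) * Complex.I) := by
        congr 1; push_cast; ring
      rw [norm_mul, norm_mul, norm_neg, Complex.norm_I, this, Complex.norm_exp_ofReal_mul_I,
        Complex.norm_real, one_mul, mul_one]
      exact hφ _
    · rw [norm_star]; exact norm_le_one_of_mem_unitaryGroup hW
  have hΦV : (Matrix.trace (Φ * V)).re =
      ∑ j, ∑ k, ‖S j k‖ ^ 2 * (φ (a j) * Real.sin (b k - a j)) := by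
    rw [hV, hΦ, trace_conj_diagonal_mul_conj_diagonal, Complex.re_sum]
    refine Finset.sum_congr rfl fun j _ => ?_
    rw [Complex.re_sum]
    refine Finset.sum_congr rfl fun k _ => ?_
    rw [Complex.re_ofReal_mul, mul_assoc (_ * _), hexp]
    congr 1
    simp [-Complex.ofReal_cos, -Complex.ofReal_sin]
  have hWW : star W * W = 1 := Unitary.star_mul_self_of_mem hW
  have hΦU : (Matrix.trace (Φ * U)).re = 0 := by
    rw [hU, hΦ, trace_conj_diagonal_mul_conj_diagonal, Complex.re_sum]
    refine Finset.sum_eq_zero fun j _ => ?_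
    rw [Complex.re_sum]
    refine Finset.sum_eq_zero fun k _ => ?_
    rw [hWW, Complex.re_ofReal_mul]
    rcases eq_or_ne j k with rfl | h
    · rw [mul_assoc (_ * _), hexp]
      simp
    · simp [Matrix.one_apply_ne h]
  have hUV : (Matrix.trace (star U * V)).re =
      ∑ j, ∑ k, ‖S j k‖ ^ 2 * Real.cos (b k - a j) := by
    have hUs : star U = W * Matrix.diagonal (fun j => Complex.exp (-(Complex.I * a j))) *
        star W := by
      rw [hU, star_mul, star_mul, star_star, Matrix.star_eq_conjTranspose (Matrix.diagonal _),
        Matrix.diagonal_conjTranspose, mul_assoc]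
      congr 3
      ext j
      rw [Pi.star_apply, RCLike.star_def, ← Complex.exp_conj]
      simp
    rw [hUs, hV, trace_conj_diagonal_mul_conj_diagonal, Complex.re_sum]
    refine Finset.sum_congr rfl fun j _ => ?_
    rw [Complex.re_sum]
    refine Finset.sum_congr rfl fun k _ => ?_
    rw [Complex.re_ofReal_mul, hexp]
    congr 1
    simp [-Complex.ofReal_cos, -Complex.ofReal_sin]
  have hUu : star U * U = 1 := Unitary.star_mul_self_of_mem (hU ▸
    mul_mem (mul_mem hW (diagonal_exp_mem_unitaryGroup a)) (Unitary.star_mem hW))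
  have hVu : star V * V = 1 := Unitary.star_mul_self_of_mem (hV ▸
    mul_mem (mul_mem hZ (diagonal_exp_mem_unitaryGroup b)) (Unitary.star_mem hZ))
  -- The left side is the squared Frobenius norm of `V - U`; each diagonal entry of `(V - U)*(V -
  -- U)` is at most `‖V - U‖²`.
  have hfrob : 2 * ((n : ℝ) - (Matrix.trace (star U * V)).re) ≤ n * ‖V - U‖ ^ 2 := by
    have h1 : (Matrix.trace (star (V - U) * (V - U))).re =
        2 * ((n : ℝ) - (Matrix.trace (star U * V)).re) := by
      have h2 : (Matrix.trace (star V * U)).re = (Matrix.trace (star U * V)).re := by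
        have : star V * U = star (star U * V) := by rw [star_mul, star_star]
        rw [this, Matrix.star_eq_conjTranspose (_ * _), Matrix.trace_conjTranspose]
        simp
      rw [star_sub, sub_mul, mul_sub, mul_sub, hUu, hVu, Matrix.trace_sub, Matrix.trace_sub,
        Matrix.trace_sub, Matrix.trace_one]
      simp only [Complex.sub_re, h2, Fintype.card_fin, Complex.natCast_re]
      ring
    rw [← h1, Matrix.trace, Complex.re_sum]
    refine (Finset.sum_le_card_nsmul _ _ (‖V - U‖ ^ 2) fun k _ => ?_).trans_eq (by simp)
    refine (Complex.re_le_norm _).trans ((norm_apply_le_l2_opNorm _ _ _).trans ?_)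
    rw [CStarRing.norm_star_mul_self, sq]
  refine ⟨Φ, hΦ1, ?_⟩
  have hrow := sum_norm_sq_row_eq_one hSu
  have hcol := sum_norm_sq_col_eq_one hSu
  -- Both sums are spread over the coupling through its marginals, so that the pointwise bound on
  -- `g` applies to each pair `(a j, b k)`.
  have hga : ∑ j, g (a j) = ∑ j, ∑ k, ‖S j k‖ ^ 2 * g (a j) := by
    simp_rw [← Finset.sum_mul, hrow, one_mul]
  have hgb : ∑ k, g (b k) = ∑ j, ∑ k, ‖S j k‖ ^ 2 * g (b k) := by
    rw [Finset.sum_comm]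
    simp_rw [← Finset.sum_mul, hcol, one_mul]
  have hn : (n : ℝ) = ∑ j : Fin n, ∑ k, ‖S j k‖ ^ 2 := by
    simp_rw [hrow]; simp
  have hmain : ∑ k, g (b k) - ∑ j, g (a j) ≤
      (Matrix.trace (Φ * V)).re + C * ((n : ℝ) - (Matrix.trace (star U * V)).re) := by
    rw [hga, hgb, hΦV, hUV, hn, ← Finset.sum_sub_distrib, ← Finset.sum_sub_distrib,
      Finset.mul_sum, ← Finset.sum_add_distrib]
    refine Finset.sum_le_sum fun j _ => ?_
    rw [← Finset.sum_sub_distrib, ← Finset.sum_sub_distrib, Finset.mul_sum,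
      ← Finset.sum_add_distrib]
    refine Finset.sum_le_sum fun k _ => ?_
    have := mul_le_mul_of_nonneg_left (hφg (a j) (b k)) (sq_nonneg ‖S j k‖)
    linarith
  rw [mul_sub, Matrix.trace_sub, Complex.sub_re, hΦU, sub_zero]
  have h0 : 0 ≤ (n : ℝ) * ‖V - U‖ ^ 2 := by positivity
  nlinarith

/-- **Dual potential estimate.** -/
theorem sum_sub_sum_le_integral_traceNorm {α : ℝ → Matrix (Fin n) (Fin n) ℂ}
    (hα : IsPiecewiseSmoothCurve α) (W : ℝ → Matrix (Fin n) (Fin n) ℂ) (a : ℝ → Fin n → ℝ)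
    (hW : ∀ t ∈ Set.Icc (0 : ℝ) 1, W t ∈ Matrix.unitaryGroup (Fin n) ℂ)
    (h : ∀ t ∈ Set.Icc (0 : ℝ) 1,
      α t = W t * Matrix.diagonal (fun j => Complex.exp (Complex.I * a t j)) * star (W t))
    {u v : ℝ} (hu : u ∈ Set.Icc (0 : ℝ) 1) (hv : v ∈ Set.Icc (0 : ℝ) 1) (huv : u ≤ v)
    {J : Set ℝ} (hau : ∀ j, a u j ∈ J) (hav : ∀ j, a v j ∈ J) {g : ℝ → ℝ}
    (hg : ∀ x ∈ J, ∀ y ∈ J, g x - g y ≤ circleDist (x - y)) :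
    ∑ j, g (a v j) - ∑ j, g (a u j) ≤ ∫ t in u..v, traceNorm (deriv α t) := by
  classical
  have := properSpace_matrix (n := n)
  -- For `n = 0` the finite set of angles below would be empty and its minimum undefined.
  rcases Nat.eq_zero_or_pos n with rfl | hn
  · simpa using intervalIntegral.integral_nonneg huv fun t _ => traceNorm_nonneg (deriv α t)
  -- Only the angles at the two end times have to be recovered in the limit `s → 1`, so a finite set
  -- of centres suffices.
  set P : Finset ℝ := Finset.univ.image (a u) ∪ Finset.univ.image (a v) with hP
  have hPu : ∀ j, a u j ∈ P := fun j =>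
    Finset.mem_union_left _ (Finset.mem_image_of_mem _ (Finset.mem_univ j))
  have hPv : ∀ j, a v j ∈ P := fun j =>
    Finset.mem_union_right _ (Finset.mem_image_of_mem _ (Finset.mem_univ j))
  have hPne : P.Nonempty := ⟨_, hPu ⟨0, hn⟩⟩
  have hPJ : ∀ x ∈ P, x ∈ J := by
    intro x hx
    rcases Finset.mem_union.1 hx with hx | hx <;> obtain ⟨j, -, rfl⟩ := Finset.mem_image.1 hx
    · exact hau j
    · exact hav j
  have hgP : ∀ x ∈ P, ∀ y ∈ P, g x - g y ≤ circleDist (x - y) :=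
    fun x hx y hy => hg x (hPJ x hx) y (hPJ y hy)
  have hlim : Filter.Tendsto (fun s =>
      ∑ j, P.inf' hPne (fun c => g c + smoothCircleDist s (a v j - c)) -
      ∑ j, P.inf' hPne (fun c => g c + smoothCircleDist s (a u j - c)))
      (nhdsWithin 1 (Set.Ico 0 1)) (nhds (∑ j, g (a v j) - ∑ j, g (a u j))) :=
    (tendsto_finsetSum _ fun j _ => tendsto_inf'_smoothCircleDist hPne g hgP (hPv j)).sub
      (tendsto_finsetSum _ fun j _ => tendsto_inf'_smoothCircleDist hPne g hgP (hPu j))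
  have hne : (nhdsWithin (1 : ℝ) (Set.Ico 0 1)).NeBot := by
    rw [← mem_closure_iff_nhdsWithin_neBot, closure_Ico zero_ne_one]
    simp
  refine le_of_tendsto hlim ?_
  filter_upwards [self_mem_nhdsWithin] with s hs
  obtain ⟨C, hC0, hC⟩ := exists_inf'_smoothCircleDist_sub_le hPne g hs.1 hs.2
  refine hα.sub_le_integral continuous_traceNorm (C := C * n)
    (F := fun t => ∑ j, P.inf' hPne (fun c => g c + smoothCircleDist s (a t j - c)))
    (by positivity) (fun x hx y hy => ?_) hu hv huv
  obtain ⟨Φ, hΦ, hΦg⟩ := exists_contraction_sum_sub_le (hW x hx) (hW y hy) (h x hx) (h y hy)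
    (g := fun r => P.inf' hPne (fun c => g c + smoothCircleDist s (r - c))) hC0 hC
  refine ⟨LinearMap.toContinuousLinearMap
    (Complex.reLm ∘ₗ (Matrix.traceLinearMap (Fin n) ℝ ℂ) ∘ₗ (LinearMap.mulLeft ℝ Φ)),
    fun T => re_trace_mul_le_traceNorm hΦ T, hΦg⟩

end Increment

/-! ### Principal logarithm of unitaries -/

section SmoothLog

/-- The derivative of the exponential is injective at `Z` as soon as `exp Z` generates `Z`. -/
lemma fderiv_exp_injective {A : Type*} [NormedRing A] [NormedAlgebra ℝ A] [CompleteSpace A]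
    {Z : A} (hZ : ∀ T : A, Commute (NormedSpace.exp Z) T → Commute Z T) :
    Function.Injective (fderiv ℝ (NormedSpace.exp : A → A) Z) := by
  let _ : NormedAlgebra ℚ A := NormedAlgebra.restrictScalars ℚ ℝ A
  rw [injective_iff_map_eq_zero]
  intro T hT
  have hd : HasFDerivAt (NormedSpace.exp : A → A) (fderiv ℝ NormedSpace.exp Z) Z :=
    (NormedSpace.exp_analytic (𝕂 := ℝ) Z).differentiableAt.hasFDerivAt
  -- Differentiating `exp W * W = W * exp W` at `Z` along a kernel vector `T` shows that `T`
  -- commutes with `exp Z`, hence with `Z`.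
  have h1 := hd.mul' (hasFDerivAt_id (𝕜 := ℝ) Z)
  have h2 := (hasFDerivAt_id (𝕜 := ℝ) Z).mul' hd
  have h3 : (fun W : A => NormedSpace.exp W * id W) = fun W => id W * NormedSpace.exp W := by
    funext W
    exact ((Commute.refl W).exp_left).eq
  have h4 : (NormedSpace.exp : A → A) * id = id * NormedSpace.exp := h3
  rw [h4] at h1
  have h5 := congrArg (fun L : A →L[ℝ] A => L T) (h1.unique h2)
  simp [hT] at h5
  have hcomm : Commute Z T := hZ T h5
  -- As `Z` and `T` commute, `exp (Z + sT) = exp Z * exp (sT)` has derivative `exp Z * T` at `s =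
  -- 0`. The chain rule gives `0`, and `exp Z` is invertible.
  have hline : HasDerivAt (fun s : ℝ => Z + s • T) T 0 := by
    simpa using ((hasDerivAt_id (0 : ℝ)).smul_const T).const_add Z
  have h6 : HasDerivAt (fun s : ℝ => NormedSpace.exp (Z + s • T)) 0 0 := by
    have hd' : HasFDerivAt (NormedSpace.exp : A → A) (fderiv ℝ NormedSpace.exp Z)
      (Z + (0 : ℝ) • T) := by simpa using hd
    have := hd'.comp_hasDerivAt (0 : ℝ) hline
    rwa [hT] at this
  have h7 : HasDerivAt (fun s : ℝ => NormedSpace.exp (Z + s • T)) (NormedSpace.exp Z * T) 0 := by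
    have : (fun s : ℝ => NormedSpace.exp (Z + s • T)) =
        fun s : ℝ => NormedSpace.exp Z * NormedSpace.exp (s • T) := by
      funext s
      exact NormedSpace.exp_add_of_commute (hcomm.smul_right s)
    rw [this]
    simpa using (hasDerivAt_exp_smul_const (𝕂 := ℝ) T (0 : ℝ)).const_mul (NormedSpace.exp Z)
  have h8 := h7.unique h6
  exact (NormedSpace.isUnit_exp Z).mul_right_eq_zero.1 h8

variable {A : Type*} [CStarAlgebra A]

/-- For `‖x‖ < π`, `x` is the argument of `e^{ix}` in the functional calculus. What commutes with a
unitary also commutes with its adjoint, being its inverse, and so with functions of it. -/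
lemma commute_of_commute_expUnitary {x : selfAdjoint A} (hx : ‖x‖ < Real.pi) {T : A}
    (hT : Commute (NormedSpace.exp (Complex.I • (x : A))) T) : Commute (Complex.I • (x : A)) T := by
  have h1 : ((Unitary.argSelfAdjoint (selfAdjoint.expUnitary x) : selfAdjoint A) : A) = x := by
    rw [argSelfAdjoint_expUnitary hx]
  rw [← selfAdjoint.expUnitary_coe] at hT
  rw [← h1, Unitary.argSelfAdjoint_coe]
  refine Commute.smul_left (Commute.cfc hT ?_ _) _
  set u := selfAdjoint.expUnitary x
  rw [← Unitary.coe_star]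
  calc (star u : unitary A) * T = (star u : unitary A) * (T * u) * (star u : unitary A) := by
        rw [mul_assoc, mul_assoc, Unitary.coe_mul_star_self, mul_one]
    _ = (star u : unitary A) * (u * T) * (star u : unitary A) := by rw [hT.eq]
    _ = T * (star u : unitary A) := by
        have hu : ((star u : unitary A) : A) * u = 1 := Unitary.coe_star_mul_self u
        rw [← mul_assoc (_ : A) (u : A) T, hu, one_mul]

lemma norm_expUnitary_sub_one_lt_two {x : selfAdjoint A} (hx : ‖x‖ < Real.pi) :
    ‖(selfAdjoint.expUnitary x - 1 : A)‖ < 2 := by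
  have h := (Unitary.openPartialHomeomorph (A := A)).map_target (x := x) (by simpa using hx)
  simpa [Subtype.dist_eq, dist_eq_norm] using h

/-- The principal logarithm of a smooth curve of unitaries is smooth. -/
theorem contDiffOn_of_expUnitary [FiniteDimensional ℝ A] {s : Set ℝ} {x : ℝ → selfAdjoint A}
    (hx : ∀ t ∈ s, ‖x t‖ < Real.pi)
    (h : ContDiffOn ℝ ∞ (fun t => NormedSpace.exp (Complex.I • (x t : A))) s) :
    ContDiffOn ℝ ∞ (fun t => (x t : A)) s := by
  have hcont : ContinuousOn (fun t => (x t : A)) s := by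
    rw [continuousOn_iff_continuous_domRestrict]
    have h1 : Continuous (fun t : s => selfAdjoint.expUnitary (x t)) :=
      Continuous.subtype_mk (continuousOn_iff_continuous_domRestrict.1 h.continuousOn) _
    have h2 : Continuous (fun t : s => Unitary.argSelfAdjoint (selfAdjoint.expUnitary (x t))) :=
      Unitary.continuousOn_argSelfAdjoint.comp_continuous h1 fun t => by
        have := norm_expUnitary_sub_one_lt_two (hx t t.2)
        simpa [Subtype.dist_eq, dist_eq_norm] using this
    have h3 : s.domRestrict (fun t => (x t : A)) = fun t : s =>
        ((Unitary.argSelfAdjoint (selfAdjoint.expUnitary (x t)) : selfAdjoint A) : A) := by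
      funext t
      rw [argSelfAdjoint_expUnitary (hx t t.2)]
      rfl
    rw [h3]
    exact continuous_subtype_val.comp h2
  intro t ht
  let _ : NormedAlgebra ℚ A := NormedAlgebra.restrictScalars ℚ ℝ A
  set Z : A := Complex.I • (x t : A) with hZ
  have hinj := fderiv_exp_injective (Z := Z) fun T hT =>
    commute_of_commute_expUnitary (hx t ht) hT
  have hcd : ContDiffAt ℝ ∞ (NormedSpace.exp : A → A) Z :=
    (NormedSpace.exp_analytic (𝕂 := ℝ) Z).contDiffAt
  let e : A ≃L[ℝ] A :=
    (LinearEquiv.ofInjectiveEndo (fderiv ℝ (NormedSpace.exp : A → A) Z : A →ₗ[ℝ] A)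
      hinj).toContinuousLinearEquiv
  have he : HasFDerivAt (NormedSpace.exp : A → A) (e : A →L[ℝ] A) Z := by
    have : (e : A →L[ℝ] A) = fderiv ℝ (NormedSpace.exp : A → A) Z := by
      ext T; rfl
    rw [this]
    exact (NormedSpace.exp_analytic (𝕂 := ℝ) Z).differentiableAt.hasFDerivAt
  -- Near `t` the logarithm is the local inverse of `exp` at `Z` applied to the curve. The
  -- continuity `hcont` keeps `i x(r)` in the domain where the local inverse is valid.
  let Φ := hcd.toOpenPartialHomeomorph _ he (by simp)
  have hΦ : ContDiffAt ℝ ∞ (hcd.localInverse he (by simp)) (NormedSpace.exp Z) :=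
    hcd.to_localInverse he (by simp)
  have h1 : ContDiffWithinAt ℝ ∞ (fun r => -Complex.I • hcd.localInverse he (by simp)
      (NormedSpace.exp (Complex.I • (x r : A)))) s t :=
    (hΦ.comp_contDiffWithinAt t (h t ht)).const_smul (-Complex.I)
  have hev : ∀ r, Complex.I • (x r : A) ∈ Φ.source → -Complex.I • hcd.localInverse he (by simp)
      (NormedSpace.exp (Complex.I • (x r : A))) = (x r : A) := by
    intro r hr
    have : hcd.localInverse he (by simp) (NormedSpace.exp (Complex.I • (x r : A))) =
        Complex.I • (x r : A) := Φ.left_inv hr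
    rw [this, smul_smul]
    simp
  have hZs : Z ∈ Φ.source := hcd.mem_toOpenPartialHomeomorph_source he (by simp)
  refine h1.congr_of_eventuallyEq ?_ (hev t hZs).symm
  have hc : Filter.Tendsto (fun r => Complex.I • (x r : A)) (nhdsWithin t s) (nhds Z) :=
    (hcont t ht).const_smul Complex.I
  filter_upwards [hc (Φ.open_source.mem_nhds hZs)] with r hr
  exact (hev r hr).symm

lemma eq_of_exp_I_smul_eq {x y : selfAdjoint A} (hx : ‖x‖ < Real.pi) (hy : ‖y‖ < Real.pi)
    (h : NormedSpace.exp (Complex.I • (x : A)) = NormedSpace.exp (Complex.I • (y : A))) :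
    x = y := by
  rw [← argSelfAdjoint_expUnitary hx, ← argSelfAdjoint_expUnitary hy]
  congr 1
  exact Subtype.ext h

/-- Every unitary matrix has a Hermitian logarithm of norm at most `π`. -/
lemma exists_exp_I_smul_eq {n : ℕ} {U : Matrix (Fin n) (Fin n) ℂ}
    (hU : U ∈ Matrix.unitaryGroup (Fin n) ℂ) :
    ∃ x : HermitianMatrix n, ‖(x : Matrix (Fin n) (Fin n) ℂ)‖ ≤ Real.pi ∧ U = expI x := by
  set u : unitary (Matrix (Fin n) (Fin n) ℂ) := ⟨U, hU⟩ with hu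
  refine ⟨Unitary.argSelfAdjoint u, Unitary.norm_argSelfAdjoint_le_pi u, ?_⟩
  -- The argument jumps across the negative axis, but every function is continuous on a finite
  -- spectrum; the eigenvalue `-1` gets the angle `π`.
  have hfin : (spectrum ℂ U).Finite := Matrix.finite_spectrum U
  have hc : ContinuousOn Complex.arg (spectrum ℂ (u : Matrix (Fin n) (Fin n) ℂ)) :=
    hfin.continuousOn _
  rw [expI, Unitary.argSelfAdjoint_coe, ← CFC.exp_eq_normedSpace_exp (𝕜 := ℂ),
    ← cfc_comp_smul .., ← cfc_comp' ..]
  conv_lhs => rw [show U = (u : Matrix (Fin n) (Fin n) ℂ) from rfl,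
    ← cfc_id' ℂ (u : Matrix (Fin n) (Fin n) ℂ)]
  refine cfc_congr fun y hy => ?_
  have hy1 : ‖y‖ = 1 := spectrum.norm_eq_one_of_unitary u.2 hy
  have hlog : Complex.I * y.arg = Complex.log y :=
    Complex.ext (by simp [Complex.log_re, hy1]) (by simp [Complex.log_im])
  have hy0 : y ≠ 0 := by
    rintro rfl
    simp at hy1
  simpa [← Complex.exp_eq_exp_ℂ, hlog] using (Complex.exp_log hy0).symm

end SmoothLog

/-! ### Ordered eigenvalues and exponentials of Hermitian matrices -/

section Eigenvalues

variable {n : ℕ}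

lemma sum_eigenvalues_eq_sum_sortedEigenvalue (A : HermitianMatrix n) (f : ℝ → ℝ) :
    ∑ j, f (Matrix.IsHermitian.eigenvalues (A := (A : Matrix (Fin n) (Fin n) ℂ)) A.2 j) =
      ∑ j, f (sortedEigenvalue j A) := by
  refine Fintype.sum_equiv ((Fintype.equivOfCardEq (Fintype.card_fin _)).symm.trans
    (finCongr (Fintype.card_fin n))) _ _ fun j => ?_
  rfl

lemma sortedEigenvalue_antitone (A : HermitianMatrix n) :
    Antitone fun j => sortedEigenvalue j A := fun _ _ hij =>
  Matrix.IsHermitian.eigenvalues₀_antitone (A := (A : Matrix (Fin n) (Fin n) ℂ)) A.2 hij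

lemma exists_sortedEigenvalue_eq (A : HermitianMatrix n) (j : Fin n) :
    ∃ i, sortedEigenvalue j A =
      Matrix.IsHermitian.eigenvalues (A := (A : Matrix (Fin n) (Fin n) ℂ)) A.2 i := by
  refine ⟨(Fintype.equivOfCardEq (Fintype.card_fin _)) (Fin.cast (Fintype.card_fin n).symm j), ?_⟩
  exact (congrArg (Matrix.IsHermitian.eigenvalues₀ (A := (A : Matrix (Fin n) (Fin n) ℂ)) A.2)
    (Equiv.symm_apply_apply _ _)).symm

lemma exists_eigenvalues_eq_sortedEigenvalue (A : HermitianMatrix n) (i : Fin n) :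
    ∃ j, Matrix.IsHermitian.eigenvalues (A := (A : Matrix (Fin n) (Fin n) ℂ)) A.2 i =
      sortedEigenvalue j A :=
  ⟨Fin.cast (Fintype.card_fin n) ((Fintype.equivOfCardEq (Fintype.card_fin _)).symm i), rfl⟩

lemma abs_sortedEigenvalue_le (A : HermitianMatrix n) (j : Fin n) :
    |sortedEigenvalue j A| ≤ ‖(A : Matrix (Fin n) (Fin n) ℂ)‖ := by
  obtain ⟨i, hi⟩ := exists_sortedEigenvalue_eq A j
  rw [hi, ← Real.norm_eq_abs]
  have hne : Nonempty (Fin n) := ⟨j⟩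
  exact spectrum.norm_le_norm_of_mem (Matrix.IsHermitian.eigenvalues_mem_spectrum_real _ i)

lemma norm_le_of_abs_sortedEigenvalue_le (A : HermitianMatrix n) {r : ℝ} (hr : 0 ≤ r)
    (h : ∀ j, |sortedEigenvalue j A| ≤ r) : ‖(A : Matrix (Fin n) (Fin n) ℂ)‖ ≤ r := by
  obtain ⟨W, hW, hf⟩ := exists_eq_conj_diagonal (A := (A : Matrix (Fin n) (Fin n) ℂ)) A.2
  have h1 := hf id
  rw [cfc_id ℝ (A : Matrix (Fin n) (Fin n) ℂ) (show IsSelfAdjoint _ from A.2)] at h1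
  rw [h1]
  have hW1 := norm_le_one_of_mem_unitaryGroup hW
  refine (norm_mul_le _ _).trans ?_
  rw [norm_star]
  refine (mul_le_of_le_one_right (norm_nonneg _) hW1).trans ((norm_mul_le _ _).trans
    ((mul_le_of_le_one_left (norm_nonneg _) hW1).trans ?_))
  rw [Matrix.l2_opNorm_diagonal, pi_norm_le_iff_of_nonneg hr]
  intro i
  obtain ⟨j, hj⟩ := exists_eigenvalues_eq_sortedEigenvalue A i
  rw [id, hj, Complex.norm_real]
  exact h j

lemma exists_expI_eq_conj_diagonal (A : HermitianMatrix n) :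
    ∃ W ∈ Matrix.unitaryGroup (Fin n) ℂ, expI (A : Matrix (Fin n) (Fin n) ℂ) =
      W * Matrix.diagonal (fun j => Complex.exp (Complex.I *
        (Matrix.IsHermitian.eigenvalues (A := (A : Matrix (Fin n) (Fin n) ℂ)) A.2 j : ℝ))) *
        star W := by
  obtain ⟨W, hW, hf⟩ := exists_eq_conj_diagonal (A := (A : Matrix (Fin n) (Fin n) ℂ)) A.2
  have h1 := hf id
  rw [cfc_id ℝ (A : Matrix (Fin n) (Fin n) ℂ) (show IsSelfAdjoint _ from A.2)] at h1
  refine ⟨W, hW, ?_⟩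
  let U : (Matrix (Fin n) (Fin n) ℂ)ˣ := Unitary.toUnits ⟨W, hW⟩
  set D := Matrix.diagonal (fun j => ((id (Matrix.IsHermitian.eigenvalues
    (A := (A : Matrix (Fin n) (Fin n) ℂ)) A.2 j) : ℝ) : ℂ)) with hD
  have h2 : Complex.I • (A : Matrix (Fin n) (Fin n) ℂ) = U * (Complex.I • D) * (U⁻¹ : _ˣ) := by
    rw [mul_smul_comm, smul_mul_assoc]
    exact congrArg (Complex.I • ·) h1
  rw [expI, h2, Matrix.exp_units_conj, hD, ← Matrix.diagonal_smul, Matrix.exp_diagonal]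
  change W * _ * star W = _
  congr 3
  ext j
  rw [Pi.coe_exp, ← Complex.exp_eq_exp_ℂ]
  rfl

lemma expI_mem_unitaryGroup (A : HermitianMatrix n) :
    expI (A : Matrix (Fin n) (Fin n) ℂ) ∈ Matrix.unitaryGroup (Fin n) ℂ :=
  (selfAdjoint.expUnitary A).2

/-- The dual potential estimate in terms of a Hermitian logarithm of the curve. -/
lemma sum_sortedEigenvalue_sub_le_integral {α : ℝ → Matrix (Fin n) (Fin n) ℂ}
    (hα : IsPiecewiseSmoothCurve α) {A : ℝ → HermitianMatrix n}
    (hA : ∀ t ∈ Set.Icc (0 : ℝ) 1, α t = expI (A t : Matrix (Fin n) (Fin n) ℂ))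
    {u v : ℝ} (hu : u ∈ Set.Icc (0 : ℝ) 1) (hv : v ∈ Set.Icc (0 : ℝ) 1) (huv : u ≤ v)
    {J : Set ℝ} (hJu : ∀ j, sortedEigenvalue j (A u) ∈ J)
    (hJv : ∀ j, sortedEigenvalue j (A v) ∈ J) {g : ℝ → ℝ}
    (hg : ∀ x ∈ J, ∀ y ∈ J, g x - g y ≤ circleDist (x - y)) :
    ∑ j, g (sortedEigenvalue j (A v)) - ∑ j, g (sortedEigenvalue j (A u)) ≤
      ∫ t in u..v, traceNorm (deriv α t) := by
  choose W hW hWA using fun t => exists_expI_eq_conj_diagonal (A t)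
  rw [← sum_eigenvalues_eq_sum_sortedEigenvalue, ← sum_eigenvalues_eq_sum_sortedEigenvalue]
  refine sum_sub_sum_le_integral_traceNorm hα W
    (fun t j => Matrix.IsHermitian.eigenvalues (A := (A t : Matrix (Fin n) (Fin n) ℂ)) (A t).2 j)
    (fun t _ => hW t) (fun t ht => (hA t ht).trans (hWA t)) hu hv huv (J := J) (fun i => ?_)
    (fun i => ?_) hg
  · obtain ⟨j, hj⟩ := exists_eigenvalues_eq_sortedEigenvalue (A u) i
    exact hj ▸ hJu j
  · obtain ⟨j, hj⟩ := exists_eigenvalues_eq_sortedEigenvalue (A v) i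
    exact hj ▸ hJv j

lemma traceNorm_eq_sum_abs (X : HermitianMatrix n) :
    traceNorm (X : Matrix (Fin n) (Fin n) ℂ) = ∑ j, |sortedEigenvalue j X| := by
  obtain ⟨W, hW, hf⟩ := exists_eq_conj_diagonal (A := (X : Matrix (Fin n) (Fin n) ℂ)) X.2
  have hWW : star W * W = 1 := Unitary.star_mul_self_of_mem hW
  rw [traceNorm, CFC.abs_eq_cfc_norm _ (show IsSelfAdjoint _ from X.2), hf, Matrix.trace_mul_comm,
    ← mul_assoc, hWW, one_mul, Matrix.trace_diagonal, Complex.re_sum]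
  exact sum_eigenvalues_eq_sum_sortedEigenvalue X fun x => |x|

/-- The one-parameter group generated by `X` has length `∑ |λ_j(X)|`. -/
lemma curveLength_expI (X : HermitianMatrix n) :
    curveLength traceNorm (fun t : ℝ => expI (t • (X : Matrix (Fin n) (Fin n) ℂ))) =
      ∑ j, |sortedEigenvalue j X| := by
  have h : ∀ t : ℝ, traceNorm
      (deriv (fun t : ℝ => expI (t • (X : Matrix (Fin n) (Fin n) ℂ))) t) =
      ∑ j, |sortedEigenvalue j X| := by
    intro t
    have hd : HasDerivAt (fun t : ℝ => expI (t • (X : Matrix (Fin n) (Fin n) ℂ)))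
        (expI (t • (X : Matrix (Fin n) (Fin n) ℂ)) *
          (Complex.I • (X : Matrix (Fin n) (Fin n) ℂ))) t := by
      simp only [expI, smul_comm Complex.I]
      exact hasDerivAt_exp_smul_const (𝕂 := ℝ) (Complex.I • (X : Matrix (Fin n) (Fin n) ℂ)) t
    have hu : star (expI (t • (X : Matrix (Fin n) (Fin n) ℂ))) *
        expI (t • (X : Matrix (Fin n) (Fin n) ℂ)) = 1 :=
      Unitary.star_mul_self_of_mem (expI_mem_unitaryGroup (t • X))
    -- A unitary left factor does not change `T* T`, and the factor `i` cancels against its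
    -- conjugate.
    rw [hd.deriv, ← traceNorm_eq_sum_abs, traceNorm, traceNorm, CFC.abs, CFC.abs, star_mul,
      mul_assoc, ← mul_assoc (star (expI _)), hu, one_mul, star_smul, smul_mul_smul_comm]
    simp
  rw [curveLength]
  simp_rw [h]
  simp

end Eigenvalues

/-! ### Tightness of minimal curves and monotone eigenvalues -/

section Minimality

variable {n : ℕ}

/-- The competitor is the one-parameter group `e^{itX}`. -/
lemma IsMinimalCurve.length_le_sum {α : ℝ → Matrix (Fin n) (Fin n) ℂ} {X : HermitianMatrix n}
    (hmin : IsMinimalCurve traceNorm (unitaryMatrices n) α) (h0 : α 0 = 1)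
    (h1 : α 1 = expI (X : Matrix (Fin n) (Fin n) ℂ)) :
    ∫ t in (0 : ℝ)..1, traceNorm (deriv α t) ≤ ∑ j, |sortedEigenvalue j X| := by
  rw [← curveLength_expI]
  refine hmin.2.2 _ (IsSmoothCurve.isPiecewiseSmoothCurve ?_) (fun t _ => ?_) ?_ ?_
  · let _ : NormedAlgebra ℚ (Matrix (Fin n) (Fin n) ℂ) := NormedAlgebra.restrictScalars ℚ ℝ _
    refine ContDiff.contDiffOn ?_
    have hexp : ContDiff ℝ ∞ (NormedSpace.exp : Matrix (Fin n) (Fin n) ℂ → _) :=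
      contDiff_iff_contDiffAt.2 fun Z => (NormedSpace.exp_analytic (𝕂 := ℝ) Z).contDiffAt
    exact hexp.comp ((contDiff_id.smul contDiff_const).const_smul Complex.I)
  · exact expI_mem_unitaryGroup (t • X)
  · simp [expI, h0]
  · simp [h1]

/-- A function on `[-r, r]` is `1`-Lipschitz for the circle distance if its increments are bounded
by the lengths of both arcs joining the two points. -/
lemma sub_le_circleDist_of_abs {g : ℝ → ℝ} {r : ℝ} (hr : r ≤ Real.pi)
    (h1 : ∀ x ∈ Set.Icc (-r) r, ∀ y ∈ Set.Icc (-r) r, g x - g y ≤ |x - y|)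
    (h2 : ∀ x ∈ Set.Icc (-r) r, ∀ y ∈ Set.Icc (-r) r, g x - g y ≤ 2 * Real.pi - |x - y|) :
    ∀ x ∈ Set.Icc (-r) r, ∀ y ∈ Set.Icc (-r) r, g x - g y ≤ circleDist (x - y) := by
  intro x hx y hy
  rcases le_total |x - y| Real.pi with h | h
  · rw [circleDist_eq_abs h]
    exact h1 x hx y hy
  · have h3 : |x - y| ≤ 2 * Real.pi := abs_le.2 ⟨by linarith [hx.1, hy.2], by linarith [hx.2, hy.1]⟩
    have h4 : circleDist (x - y) = 2 * Real.pi - |x - y| := by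
      rw [circleDist, ← Real.cos_abs, ← Real.cos_two_pi_sub,
        Real.arccos_cos (by linarith) (by linarith)]
    rw [h4]
    exact h2 x hx y hy

/-- A Hermitian logarithm, with spectrum in `[-π, π]`, of a minimal curve. -/
structure IsMinimalLog (α : ℝ → Matrix (Fin n) (Fin n) ℂ) (X : HermitianMatrix n)
    (A : ℝ → HermitianMatrix n) : Prop where
  piecewise : IsPiecewiseSmoothCurve α
  length_le : ∫ t in (0 : ℝ)..1, traceNorm (deriv α t) ≤ ∑ j, |sortedEigenvalue j X|
  norm_lt : ‖(X : Matrix (Fin n) (Fin n) ℂ)‖ < Real.pi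
  norm_le : ∀ t ∈ Set.Icc (0 : ℝ) 1, ‖(A t : Matrix (Fin n) (Fin n) ℂ)‖ ≤ Real.pi
  eq_expI : ∀ t ∈ Set.Icc (0 : ℝ) 1, α t = expI (A t : Matrix (Fin n) (Fin n) ℂ)
  at_zero : A 0 = 0
  at_one : A 1 = X

lemma sum_abs_sortedEigenvalue_zero : ∑ j : Fin n, |sortedEigenvalue j (0 : HermitianMatrix n)| = 0 :=
  Finset.sum_eq_zero fun j _ => le_antisymm
    ((abs_sortedEigenvalue_le _ j).trans_eq (by simp)) (abs_nonneg _)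

variable {α : ℝ → Matrix (Fin n) (Fin n) ℂ} {X : HermitianMatrix n} {A : ℝ → HermitianMatrix n}

lemma IsMinimalLog.integral_add (h : IsMinimalLog α X A) {u v w : ℝ}
    (hu : u ∈ Set.Icc (0 : ℝ) 1) (hv : v ∈ Set.Icc (0 : ℝ) 1) (hw : w ∈ Set.Icc (0 : ℝ) 1) :
    (∫ t in u..v, traceNorm (deriv α t)) + ∫ t in v..w, traceNorm (deriv α t) =
      ∫ t in u..w, traceNorm (deriv α t) := by
  have := properSpace_matrix (n := n)
  exact intervalIntegral.integral_add_adjacent_intervals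
    (h.piecewise.intervalIntegrable_comp_deriv continuous_traceNorm hu hv)
    (h.piecewise.intervalIntegrable_comp_deriv continuous_traceNorm hv hw)

lemma IsMinimalLog.abs_sortedEigenvalue_le_pi (h : IsMinimalLog α X A) {t : ℝ}
    (ht : t ∈ Set.Icc (0 : ℝ) 1) (j : Fin n) : |sortedEigenvalue j (A t)| ≤ Real.pi :=
  (abs_sortedEigenvalue_le _ j).trans (h.norm_le t ht)

/-- The potential is the circle distance to `0`, equal to `|x|` on `[-π, π]`. -/
lemma IsMinimalLog.sum_abs_sub_le (h : IsMinimalLog α X A) {u v : ℝ}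
    (hu : u ∈ Set.Icc (0 : ℝ) 1) (hv : v ∈ Set.Icc (0 : ℝ) 1) (huv : u ≤ v) :
    ∑ j, |sortedEigenvalue j (A v)| - ∑ j, |sortedEigenvalue j (A u)| ≤
      ∫ t in u..v, traceNorm (deriv α t) := by
  have key : ∀ {w : ℝ}, w ∈ Set.Icc (0 : ℝ) 1 →
      ∑ j, |sortedEigenvalue j (A w)| = ∑ j, circleDist (sortedEigenvalue j (A w)) := fun hw =>
    Finset.sum_congr rfl fun j _ => (circleDist_eq_abs (h.abs_sortedEigenvalue_le_pi hw j)).symm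
  rw [key hu, key hv]
  exact sum_sortedEigenvalue_sub_le_integral h.piecewise h.eq_expI hu hv huv (J := Set.univ)
    (fun _ => trivial) (fun _ => trivial) fun x _ y _ => circleDist_sub_le x y

/-- The spectrum of the logarithm of a minimal curve stays in `[-‖X‖, ‖X‖]`. -/
lemma IsMinimalLog.abs_sortedEigenvalue_le (h : IsMinimalLog α X A) {t : ℝ}
    (ht : t ∈ Set.Icc (0 : ℝ) 1) (j : Fin n) :
    |sortedEigenvalue j (A t)| ≤ ‖(X : Matrix (Fin n) (Fin n) ℂ)‖ := by
  set r := ‖(X : Matrix (Fin n) (Fin n) ℂ)‖ with hr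
  have h0 : (0 : ℝ) ∈ Set.Icc (0 : ℝ) 1 := by simp
  have h1 : (1 : ℝ) ∈ Set.Icc (0 : ℝ) 1 := by simp
  have e1 := h.sum_abs_sub_le h0 ht ht.1
  rw [h.at_zero, sum_abs_sortedEigenvalue_zero, sub_zero] at e1
  -- After time `t` the distance is truncated at `r`, which loses nothing at time `1`. Adding the
  -- untruncated bound on `[0, t]` and comparing with the total length leaves no room for
  -- eigenvalues beyond `r`.
  have e2 := sum_sortedEigenvalue_sub_le_integral h.piecewise h.eq_expI ht h1 ht.2 (J := Set.univ)
    (fun _ => trivial) (fun _ => trivial) (g := fun x => min (circleDist x) r) fun x _ y _ => by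
      have := circleDist_sub_le x y
      have h3 : 0 ≤ circleDist (x - y) := Real.arccos_nonneg _
      rcases le_total (circleDist y) r with hy | hy
      · simp only [min_eq_left hy]
        linarith [min_le_left (circleDist x) r]
      · simp only [min_eq_right hy]
        linarith [min_le_right (circleDist x) r]
  have e3 : ∑ j, min (circleDist (sortedEigenvalue j (A 1))) r =
      ∑ j, |sortedEigenvalue j X| := by
    rw [h.at_one]
    refine Finset.sum_congr rfl fun i _ => ?_
    have hi := _root_.abs_sortedEigenvalue_le X i
    rw [circleDist_eq_abs (hi.trans h.norm_lt.le), min_eq_left hi]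
  have e4 := h.integral_add h0 ht h1
  have e5 := h.length_le
  have e6 : ∑ j, (|sortedEigenvalue j (A t)| - min (circleDist (sortedEigenvalue j (A t))) r) ≤
      0 := by
    rw [Finset.sum_sub_distrib]
    linarith
  have e7 : ∀ i ∈ Finset.univ, 0 ≤
      |sortedEigenvalue i (A t)| - min (circleDist (sortedEigenvalue i (A t))) r := fun i _ => by
    rw [circleDist_eq_abs (h.abs_sortedEigenvalue_le_pi ht i)]
    linarith [min_le_left |sortedEigenvalue i (A t)| r]
  have e8 := (Finset.sum_eq_zero_iff_of_nonneg e7).1 (le_antisymm e6 (Finset.sum_nonneg e7)) j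
    (Finset.mem_univ j)
  linarith [min_le_right (circleDist (sortedEigenvalue j (A t))) r]

/-- Tightness on subintervals: `[0, u]` and `[v, 1]` already use up their share of the total length
`∑ |λ_j(X)|`. -/
lemma IsMinimalLog.integral_le (h : IsMinimalLog α X A) {u v : ℝ}
    (hu : u ∈ Set.Icc (0 : ℝ) 1) (hv : v ∈ Set.Icc (0 : ℝ) 1) :
    ∫ t in u..v, traceNorm (deriv α t) ≤
      ∑ j, |sortedEigenvalue j (A v)| - ∑ j, |sortedEigenvalue j (A u)| := by
  have h0 : (0 : ℝ) ∈ Set.Icc (0 : ℝ) 1 := by simp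
  have h1 : (1 : ℝ) ∈ Set.Icc (0 : ℝ) 1 := by simp
  have e1 := h.sum_abs_sub_le h0 hu hu.1
  have e2 := h.sum_abs_sub_le hv h1 hv.2
  rw [h.at_zero, sum_abs_sortedEigenvalue_zero, sub_zero] at e1
  rw [h.at_one] at e2
  have e3 := h.integral_add h0 hu hv
  have e4 := h.integral_add h0 hv h1
  have e5 := h.length_le
  linarith

/-- The truncated ramp is non-decreasing and 1-Lipschitz. -/
lemma min_max_sub_sub_le (c ε x y : ℝ) :
    min (max (x - c) 0) ε - min (max (y - c) 0) ε ≤ max (x - y) 0 := by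
  rcases le_total x y with h | h
  · have : min (max (x - c) 0) ε ≤ min (max (y - c) 0) ε := by gcongr
    linarith [le_max_right (x - y) 0]
  · grind

/-- The truncations of the positive parts of the eigenvalues have non-decreasing sum. -/
lemma IsMinimalLog.sum_min_max_le (h : IsMinimalLog α X A) {u v : ℝ}
    (hu : u ∈ Set.Icc (0 : ℝ) 1) (hv : v ∈ Set.Icc (0 : ℝ) 1) (huv : u ≤ v) {c ε : ℝ}
    (hc : 0 ≤ c) (hε : 0 ≤ ε) (hε' : ε ≤ 2 * (Real.pi - ‖(X : Matrix (Fin n) (Fin n) ℂ)‖))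
    {σ : ℝ} (hσ : σ = 1 ∨ σ = -1) :
    ∑ j, min (max (σ * sortedEigenvalue j (A u) - c) 0) ε ≤
      ∑ j, min (max (σ * sortedEigenvalue j (A v) - c) 0) ε := by
  set r := ‖(X : Matrix (Fin n) (Fin n) ℂ)‖ with hr
  have hJ : ∀ t ∈ Set.Icc (0 : ℝ) 1, ∀ j, sortedEigenvalue j (A t) ∈ Set.Icc (-r) r :=
    fun t ht j => abs_le.1 (h.abs_sortedEigenvalue_le ht j)
  have hm0 : ∀ x : ℝ, 0 ≤ min (max (x - c) 0) ε := fun x => le_min (le_max_right _ _) hε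
  -- The layer is subtracted from `|x|`, for which the estimate is tight; cancelling the `|x|` sums
  -- leaves the claim for the layers.
  have e1 := sum_sortedEigenvalue_sub_le_integral h.piecewise h.eq_expI hu hv huv
    (hJ u hu) (hJ v hv) (g := fun x => |x| - min (max (σ * x - c) 0) ε)
    (sub_le_circleDist_of_abs h.norm_lt.le (fun x hx y hy => ?_) (fun x hx y hy => ?_))
  · have e2 := h.integral_le hu hv
    rw [Finset.sum_sub_distrib, Finset.sum_sub_distrib] at e1
    linarith
  · have l1 := min_max_sub_sub_le c ε (σ * y) (σ * x)
    have l2 : min (max (σ * y - c) 0) ε ≤ max (σ * y) 0 :=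
      (min_le_left _ _).trans (max_le_max_right 0 (by linarith))
    have l3 := hm0 (σ * x)
    generalize min (max (σ * y - c) 0) ε = p at *
    generalize min (max (σ * x - c) 0) ε = q at *
    rcases hσ with rfl | rfl <;> simp only [one_mul, neg_one_mul] at * <;>
      rcases abs_cases x with ⟨hx1, hx2⟩ | ⟨hx1, hx2⟩ <;>
      rcases abs_cases y with ⟨hy1, hy2⟩ | ⟨hy1, hy2⟩ <;>
      rcases abs_cases (x - y) with ⟨hz1, hz2⟩ | ⟨hz1, hz2⟩ <;>
      grind
  -- The arc through `-1`: the increment is at most `|x| - |y| + ε ≤ 2r - |x - y| + ε`, and `ε ≤ 2(π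
  -- - r)` is exactly what makes this at most `2π - |x - y|`.
  · have l1 := min_le_right (max (σ * y - c) 0) ε
    have l2 := hm0 (σ * x)
    have l3 : |x| ≤ r := abs_le.2 hx
    have l4 : |x - y| ≤ |x| + |y| := abs_sub _ _
    linarith

/-- Domination of the truncated sums forces domination of the ordered positive parts. -/
lemma le_max_zero_of_sum_min_max_le {a b : Fin n → ℝ} (ha : Antitone a) (hb : Antitone b)
    {δ : ℝ} (hδ : 0 < δ)
    (h : ∀ c ε : ℝ, 0 ≤ c → 0 ≤ ε → ε ≤ δ →
      ∑ j, min (max (a j - c) 0) ε ≤ ∑ j, min (max (b j - c) 0) ε) (j : Fin n) :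
    a j ≤ max (b j) 0 := by
  by_contra! hlt
  -- The layer of height `ε` above `c` is filled by every `a i` with `i ≤ j`, but only entries `b i`
  -- with `i < j` can reach it: one more full layer on the left than on the right.
  set c := max (b j) 0 with hc
  set ε := min (a j - c) δ with hε
  have hε0 : 0 < ε := lt_min (sub_pos.2 hlt) hδ
  have h1 := h c ε (le_max_right _ _) hε0.le (min_le_right _ _)
  have h2 : ∑ i, min (max (b i - c) 0) ε ≤ ∑ i, (if i < j then ε else 0) := by
    refine Finset.sum_le_sum fun i _ => ?_
    split_ifs with hij
    · exact min_le_right _ _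
    · have : b i ≤ c := (hb (not_lt.1 hij)).trans (le_max_left _ _)
      rw [max_eq_right (by linarith)]
      exact min_le_left _ _
  have h3 : ∑ i, (if i ≤ j then ε else 0) ≤ ∑ i, min (max (a i - c) 0) ε := by
    refine Finset.sum_le_sum fun i _ => ?_
    split_ifs with hij
    · have : ε ≤ a i - c := (min_le_left _ _).trans (sub_le_sub_right (ha hij) c)
      exact le_min (this.trans (le_max_left _ _)) le_rfl
    · exact le_min (le_max_right _ _) hε0.le
  have h4 : ∑ i, (if i < j then ε else 0) < ∑ i, (if i ≤ j then ε else 0) := by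
    refine Finset.sum_lt_sum (fun i _ => ?_) ⟨j, Finset.mem_univ j, by simp [hε0]⟩
    split_ifs with h5 h6
    · exact le_rfl
    · exact absurd h5.le h6
    · exact hε0.le
    · exact le_rfl
  linarith

lemma IsMinimalLog.sortedEigenvalue_le_max (h : IsMinimalLog α X A) {u v : ℝ}
    (hu : u ∈ Set.Icc (0 : ℝ) 1) (hv : v ∈ Set.Icc (0 : ℝ) 1) (huv : u ≤ v) (j : Fin n) :
    sortedEigenvalue j (A u) ≤ max (sortedEigenvalue j (A v)) 0 := by
  refine le_max_zero_of_sum_min_max_le (sortedEigenvalue_antitone (A u))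
    (sortedEigenvalue_antitone (A v)) (δ := 2 * (Real.pi - ‖(X : Matrix (Fin n) (Fin n) ℂ)‖))
    (by linarith [h.norm_lt]) (fun c ε hc hε hε' => ?_) j
  simpa using h.sum_min_max_le hu hv huv hc hε hε' (Or.inl rfl)

lemma IsMinimalLog.neg_sortedEigenvalue_le_max (h : IsMinimalLog α X A) {u v : ℝ}
    (hu : u ∈ Set.Icc (0 : ℝ) 1) (hv : v ∈ Set.Icc (0 : ℝ) 1) (huv : u ≤ v) (j : Fin n) :
    -sortedEigenvalue j (A u) ≤ max (-sortedEigenvalue j (A v)) 0 := by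
  -- Negation reverses the order, so the index is reversed to keep an antitone family.
  have hanti : ∀ B : HermitianMatrix n, Antitone fun i : Fin n => -sortedEigenvalue i.rev B :=
    fun B i k hik => neg_le_neg (sortedEigenvalue_antitone B (Fin.rev_le_rev.2 hik))
  have key := le_max_zero_of_sum_min_max_le (hanti (A u)) (hanti (A v))
    (δ := 2 * (Real.pi - ‖(X : Matrix (Fin n) (Fin n) ℂ)‖))
    (by linarith [h.norm_lt]) (fun c ε hc hε hε' => ?_) j.rev
  · simpa using key
  · have e := h.sum_min_max_le hu hv huv hc hε hε' (Or.inr rfl)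
    rw [← Equiv.sum_comp Fin.revPerm, ← Equiv.sum_comp Fin.revPerm
      (fun j => min (max (-1 * sortedEigenvalue j (A v) - c) 0) ε)] at e
    simpa using e

/-- The ordered eigenvalues of the logarithm of a minimal curve are monotone. -/
theorem IsMinimalLog.monotoneOn_or_antitoneOn (h : IsMinimalLog α X A) (j : Fin n) :
    MonotoneOn (fun t => sortedEigenvalue j (A t)) (Set.Icc 0 1) ∨
      AntitoneOn (fun t => sortedEigenvalue j (A t)) (Set.Icc 0 1) := by
  have h1 : (1 : ℝ) ∈ Set.Icc (0 : ℝ) 1 := by simp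
  -- If the final value is nonnegative, the negative part, which cannot decrease, vanishes at all
  -- times, and the eigenvalue equals its non-decreasing positive part. The other case is symmetric.
  rcases le_total 0 (sortedEigenvalue j (A 1)) with h0 | h0
  · left
    intro u hu v hv huv
    have e1 := h.sortedEigenvalue_le_max hu hv huv j
    have e2 := h.neg_sortedEigenvalue_le_max hv h1 hv.2 j
    rw [max_eq_right (neg_nonpos.2 h0)] at e2
    rwa [max_eq_left (by linarith)] at e1
  · right
    intro u hu v hv huv
    have e1 := h.neg_sortedEigenvalue_le_max hu hv huv j
    have e2 := h.sortedEigenvalue_le_max hv h1 hv.2 j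
    rw [max_eq_right h0] at e2
    rw [max_eq_left (by linarith)] at e1
    exact neg_le_neg_iff.1 e1

end Minimality

/-! ### Lengths on the line and on the circle -/

section Length

lemma norm_exp_sub_exp_sq (a b : ℝ) :
    ‖Complex.exp (Complex.I * b) - Complex.exp (Complex.I * a)‖ ^ 2 =
      2 * (1 - Real.cos (b - a)) := by
  rw [Complex.sq_norm, Complex.normSq_apply, mul_comm Complex.I, mul_comm Complex.I,
    Complex.sub_re, Complex.sub_im, Complex.exp_ofReal_mul_I_re, Complex.exp_ofReal_mul_I_re,
    Complex.exp_ofReal_mul_I_im, Complex.exp_ofReal_mul_I_im, Real.cos_sub]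
  nlinarith [Real.sin_sq_add_cos_sq a, Real.sin_sq_add_cos_sq b]

/-- A curve in the circle from `1` to `e^{ix}` has length at least the angle `|x| ≤ π`. -/
lemma abs_le_curveLength_circle {β : ℝ → ℂ} (hβ : IsPiecewiseSmoothCurve β)
    (hS : ∀ t ∈ Set.Icc (0 : ℝ) 1, ‖β t‖ = 1) (h0 : β 0 = 1) {x : ℝ} (hx : |x| ≤ Real.pi)
    (h1 : β 1 = Complex.exp (Complex.I * x)) :
    |x| ≤ curveLength (fun z : ℂ => ‖z‖) β := by
  have hm0 : (0 : ℝ) ∈ Set.Icc (0 : ℝ) 1 := by simp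
  have hm1 : (1 : ℝ) ∈ Set.Icc (0 : ℝ) 1 := by simp
  -- The angle need not be continuous in `t`, since the potential depends on it only through its
  -- cosine. Its end values are prescribed as `0` and `x`.
  have hb : ∀ t, ∃ b : ℝ, (t ∈ Set.Icc (0 : ℝ) 1 → β t = Complex.exp (Complex.I * b)) ∧
      (t = 0 → b = 0) ∧ (t = 1 → b = x) := by
    intro t
    by_cases ht0 : t = 0
    · exact ⟨0, by simp [ht0, h0], by simp, by simp [ht0]⟩
    by_cases ht1 : t = 1
    · exact ⟨x, by simp [ht1, h1], by simp [ht1], by simp⟩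
    · refine ⟨Complex.arg (β t), fun ht => ?_, by simp [ht0], by simp [ht1]⟩
      have := Complex.norm_mul_exp_arg_mul_I (β t)
      rw [hS t ht, Complex.ofReal_one, one_mul, mul_comm] at this
      exact this.symm
  choose b hb hb0 hb1 using hb
  have hlim : Filter.Tendsto (fun s => smoothCircleDist s x - smoothCircleDist s 0)
      (nhdsWithin 1 (Set.Ico 0 1)) (nhds |x|) := by
    have hc : Continuous fun s => smoothCircleDist s x - smoothCircleDist s 0 := by
      simp only [smoothCircleDist]
      fun_prop
    have h2 := hc.tendsto 1
    have h3 : smoothCircleDist 1 x - smoothCircleDist 1 0 = |x| := by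
      rw [← circleDist_eq_abs hx]
      simp [smoothCircleDist, circleDist]
    rw [h3] at h2
    exact tendsto_nhdsWithin_of_tendsto_nhds h2
  have hne : (nhdsWithin (1 : ℝ) (Set.Ico 0 1)).NeBot := by
    rw [← mem_closure_iff_nhdsWithin_neBot, closure_Ico zero_ne_one]
    simp
  refine le_of_tendsto hlim ?_
  filter_upwards [self_mem_nhdsWithin] with s hs
  obtain ⟨C, hC0, hC⟩ := exists_smoothCircleDist_sub_le hs.1 hs.2
  have key := hβ.sub_le_integral continuous_norm (C := C)
    (F := fun t => smoothCircleDist s (b t)) hC0 (fun u hu v hv => ?_) hm0 hm1 zero_le_one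
  · simp only [hb0 0 rfl, hb1 1 rfl] at key
    exact key
  obtain ⟨φ, hφ, h⟩ := hC (b u)
  -- The scalar analogue of the contraction `Φ` in `exists_contraction_sum_sub_le`.
  set w : ℂ := -Complex.I * φ * Complex.exp (Complex.I * ((-b u : ℝ) : ℂ)) with hw
  have hw1 : ‖w‖ ≤ 1 := by
    rw [hw, mul_comm Complex.I ((-b u : ℝ) : ℂ), norm_mul, norm_mul, Complex.norm_exp_ofReal_mul_I,
      norm_neg, Complex.norm_I, Complex.norm_real, one_mul, mul_one]
    exact hφ
  refine ⟨Complex.reCLM ∘L (ContinuousLinearMap.mul ℝ ℂ w), fun z => ?_, ?_⟩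
  · refine (Complex.re_le_norm (w * z)).trans ?_
    rw [norm_mul]
    exact mul_le_of_le_one_left (norm_nonneg z) hw1
  · have e1 : ∀ y : ℝ, (w * Complex.exp (Complex.I * y)).re = φ * Real.sin (y - b u) := by
      intro y
      have : w * Complex.exp (Complex.I * y) =
          φ * (-Complex.I * Complex.exp (((y - b u : ℝ) : ℂ) * Complex.I)) := by
        have h4 : ((y - b u : ℝ) : ℂ) * Complex.I =
          Complex.I * ((-b u : ℝ) : ℂ) + Complex.I * y := by push_cast; ring
        rw [h4, Complex.exp_add, hw]
        ring
      rw [this, Complex.re_ofReal_mul, neg_mul, Complex.neg_re, Complex.I_mul_re, neg_neg,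
        Complex.exp_ofReal_mul_I_im]
    have e2 : (Complex.reCLM ∘L (ContinuousLinearMap.mul ℝ ℂ w)) (β v - β u) =
        φ * Real.sin (b v - b u) := by
      change (w * (β v - β u)).re = _
      rw [hb u hu, hb v hv, mul_sub, Complex.sub_re, e1, e1]
      simp
    rw [e2, hb u hu, hb v hv, norm_exp_sub_exp_sq]
    have h5 := h (b v)
    have h6 : 0 ≤ C * (1 - Real.cos (b v - b u)) :=
      mul_nonneg hC0 (by linarith [Real.cos_le_one (b v - b u)])
    linarith

lemma IsPiecewiseSmoothCurve.integral_deriv_eq_sub {f : ℝ → ℝ} (hf : IsPiecewiseSmoothCurve f) :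
    ∫ t in (0 : ℝ)..1, deriv f t = f 1 - f 0 :=
  hf.integral_clm_deriv_eq_sub (by simp) (by simp) (ContinuousLinearMap.id ℝ ℝ)

lemma IsPiecewiseSmoothCurve.abs_sub_le_curveLength {f : ℝ → ℝ} (hf : IsPiecewiseSmoothCurve f) :
    |f 1 - f 0| ≤ curveLength (fun x : ℝ => |x|) f := by
  rw [← hf.integral_deriv_eq_sub]
  exact intervalIntegral.abs_integral_le_integral_abs zero_le_one

lemma IsPiecewiseSmoothCurve.curveLength_eq_of_monotoneOn {f : ℝ → ℝ}
    (hf : IsPiecewiseSmoothCurve f)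
    (hm : MonotoneOn f (Set.Icc 0 1) ∨ AntitoneOn f (Set.Icc 0 1)) :
    curveLength (fun x : ℝ => |x|) f = |f 1 - f 0| := by
  have h0 : (0 : ℝ) ∈ Set.Icc (0 : ℝ) 1 := by simp
  have h1 : (1 : ℝ) ∈ Set.Icc (0 : ℝ) 1 := by simp
  have hd : ∀ t ∈ Set.Ioo (0 : ℝ) 1, derivWithin f (Set.Icc 0 1) t = deriv f t := fun t ht =>
    derivWithin_of_mem_nhds (Icc_mem_nhds ht.1 ht.2)
  rw [curveLength, intervalIntegral.integral_of_le zero_le_one,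
    MeasureTheory.integral_Ioc_eq_integral_Ioo]
  rcases hm with hm | hm
  · rw [abs_of_nonneg (sub_nonneg.2 (hm h0 h1 zero_le_one)), ← hf.integral_deriv_eq_sub,
      intervalIntegral.integral_of_le zero_le_one, MeasureTheory.integral_Ioc_eq_integral_Ioo]
    refine MeasureTheory.setIntegral_congr_fun measurableSet_Ioo fun t ht => abs_of_nonneg ?_
    rw [← hd t ht]
    exact hm.derivWithin_nonneg
  · rw [abs_of_nonpos (sub_nonpos.2 (hm h0 h1 zero_le_one)), ← hf.integral_deriv_eq_sub,
      intervalIntegral.integral_of_le zero_le_one, MeasureTheory.integral_Ioc_eq_integral_Ioo,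
      ← MeasureTheory.integral_neg]
    refine MeasureTheory.setIntegral_congr_fun measurableSet_Ioo fun t ht => abs_of_nonpos ?_
    rw [← hd t ht]
    exact hm.derivWithin_nonpos

/-- Since `|f| < π`, the circle curve avoids the cut and `f` is the imaginary part of its principal
logarithm. This transfers the regularity assumed on the circle to the eigenvalues themselves. -/
lemma IsPiecewiseSmoothCurve.of_exp {f : ℝ → ℝ}
    (hf : IsPiecewiseSmoothCurve fun t => Complex.exp (Complex.I * (f t : ℂ)))
    (hπ : ∀ t ∈ Set.Icc (0 : ℝ) 1, |f t| < Real.pi) : IsPiecewiseSmoothCurve f := by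
  have hlog : ∀ t ∈ Set.Icc (0 : ℝ) 1,
      f t = (Complex.log (Complex.exp (Complex.I * (f t : ℂ)))).im := by
    intro t ht
    have h := abs_lt.1 (hπ t ht)
    rw [Complex.log_exp (by simpa using h.1) (by simpa using h.2.le)]
    simp
  have hslit : ∀ t ∈ Set.Icc (0 : ℝ) 1,
      Complex.exp (Complex.I * (f t : ℂ)) ∈ Complex.slitPlane := by
    intro t ht
    rw [Complex.mem_slitPlane_iff_arg]
    refine ⟨?_, Complex.exp_ne_zero _⟩
    rw [← Complex.log_im, ← hlog t ht]
    exact (abs_lt.1 (hπ t ht)).2.ne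
  have hlogs : ∀ z ∈ Complex.slitPlane, ContDiffAt ℝ ∞ (fun z => (Complex.log z).im) z :=
    fun z hz => Complex.imCLM.contDiff.contDiffAt.comp z
      ((Complex.contDiffAt_log hz).restrict_scalars ℝ)
  obtain ⟨hc, m, t, ht, h0, h1, hs⟩ := hf
  refine ⟨?_, m, t, ht, h0, h1, fun i => ?_⟩
  · refine ContinuousOn.congr (fun r hr => ?_) hlog
    exact ContinuousAt.comp_continuousWithinAt (g := fun z => (Complex.log z).im)
      (hlogs _ (hslit r hr)).continuousAt (hc r hr)
  · have hsub : Set.Icc (t i.castSucc) (t i.succ) ⊆ Set.Icc (0 : ℝ) 1 :=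
      Set.Icc_subset_Icc (h0 ▸ ht.monotone (Fin.zero_le _)) (h1 ▸ ht.monotone (Fin.le_last _))
    refine ContDiffOn.congr (fun r hr => ?_) fun r hr => hlog r (hsub hr)
    exact ContDiffAt.comp_contDiffWithinAt (g := fun z => (Complex.log z).im) r
      (hlogs _ (hslit r (hsub hr))) (hs i r hr)

lemma IsPiecewiseSmoothCurve.curveLength_exp {f : ℝ → ℝ} (hf : IsPiecewiseSmoothCurve f) :
    curveLength (fun z : ℂ => ‖z‖) (fun t => Complex.exp (Complex.I * (f t : ℂ))) =
      curveLength (fun x : ℝ => |x|) f := by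
  obtain ⟨T, K, hT⟩ := hf.exists_finset_contDiffAt
  refine intervalIntegral.integral_congr_ae ?_
  have h0 : ∀ᵐ t : ℝ, t ∉ (T : Set ℝ) :=
    MeasureTheory.measure_eq_zero_iff_ae_notMem.1 (T.finite_toSet.measure_zero _)
  filter_upwards [h0] with t ht ht'
  have htm : t ∈ Set.Icc (0 : ℝ) 1 := by
    rw [Set.uIoc_of_le zero_le_one] at ht'
    exact Set.Ioc_subset_Icc_self ht'
  have hd := ((hT t htm ht).1.differentiableAt (by simp)).hasDerivAt
  have h2 := ((hd.ofReal_comp).const_mul Complex.I).cexp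
  rw [h2.deriv, norm_mul, norm_mul, Complex.norm_I, one_mul, mul_comm Complex.I,
    Complex.norm_exp_ofReal_mul_I, one_mul, Complex.norm_real, Real.norm_eq_abs]

end Length

/-! ### Main theorem -/

theorem mainTheorem10 (n : ℕ) (α : ℝ → Matrix (Fin n) (Fin n) ℂ) (X : HermitianMatrix n)
    (hX : ‖(X : Matrix (Fin n) (Fin n) ℂ)‖ < Real.pi)
    (hsmooth : IsSmoothCurve α)
    (hmin : IsMinimalCurve traceNorm (unitaryMatrices n) α)
    (h0 : α 0 = 1)
    (h1 : α 1 = expI (X : Matrix (Fin n) (Fin n) ℂ)) :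
    (∃ Y : ℝ → HermitianMatrix n, IsSmoothLog α Y) ∧
    ∀ Y : ℝ → HermitianMatrix n, IsSmoothLog α Y →
      (∀ Z : ℝ → HermitianMatrix n, IsSmoothLog α Z → Set.EqOn Z Y (Set.Icc 0 1)) ∧
      ((∀ j : Fin n, IsPiecewiseSmoothCurve (eigenvalueCurve Y j)) →
        (∀ j : Fin n,
          (MonotoneOn (fun t => sortedEigenvalue j (Y t)) (Set.Icc 0 1) ∨
            AntitoneOn (fun t => sortedEigenvalue j (Y t)) (Set.Icc 0 1)) ∧
          IsMinimalCurve (fun x : ℝ => |x|) Set.univ (fun t => sortedEigenvalue j (Y t))) ∧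
        (∀ j : Fin n,
          IsMinimalCurve (fun z : ℂ => ‖z‖) {z : ℂ | ‖z‖ = 1} (eigenvalueCurve Y j))) := by
  have hm0 : (0 : ℝ) ∈ Set.Icc (0 : ℝ) 1 := by simp
  have hm1 : (1 : ℝ) ∈ Set.Icc (0 : ℝ) 1 := by simp
  have hexp0 : expI ((0 : HermitianMatrix n) : Matrix (Fin n) (Fin n) ℂ) = 1 := by simp [expI]
  have hlen := hmin.length_le_sum h0 h1
  refine ⟨?_, fun Y hY => ⟨fun Z hZ t ht => eq_of_exp_I_smul_eq (hZ.2 t ht).2 (hY.2 t ht).2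
    ((hZ.2 t ht).1.symm.trans (hY.2 t ht).1), fun hpw => ?_⟩⟩
  -- Logarithms of norm at most `π` are chosen pointwise, with the values `0` and `X` imposed at the
  -- ends. Minimality then confines their spectra below `π`, which makes the choice principal and
  -- hence smooth.
  · have hA : ∀ t : ℝ, ∃ B : HermitianMatrix n, (t ∈ Set.Icc (0 : ℝ) 1 →
        ‖(B : Matrix (Fin n) (Fin n) ℂ)‖ ≤ Real.pi ∧
          α t = expI (B : Matrix (Fin n) (Fin n) ℂ)) ∧ (t = 0 → B = 0) ∧ (t = 1 → B = X) := by
      intro t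
      by_cases ht0 : t = 0
      · exact ⟨0, fun _ => ⟨by simp [Real.pi_pos.le], by rw [ht0, h0, hexp0]⟩, by simp, by simp [ht0]⟩
      by_cases ht1 : t = 1
      · exact ⟨X, by simp [ht1, h1, hX.le], by simp [ht1], by simp⟩
      by_cases ht : t ∈ Set.Icc (0 : ℝ) 1
      · obtain ⟨B, hB⟩ := exists_exp_I_smul_eq (hmin.2.1 t ht)
        exact ⟨B, fun _ => hB, by simp [ht0], by simp [ht1]⟩
      · exact ⟨0, fun h => absurd h ht, by simp [ht0], by simp [ht1]⟩
    choose A hA hA0 hA1 using hA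
    have hlog : IsMinimalLog α X A := ⟨hmin.1, hlen, hX, fun t ht => (hA t ht).1,
      fun t ht => (hA t ht).2, hA0 0 rfl, hA1 1 rfl⟩
    have hlt : ∀ t ∈ Set.Icc (0 : ℝ) 1, ‖(A t : Matrix (Fin n) (Fin n) ℂ)‖ < Real.pi := fun t ht =>
      (norm_le_of_abs_sortedEigenvalue_le _ (norm_nonneg _)
        (hlog.abs_sortedEigenvalue_le ht)).trans_lt hX
    have : FiniteDimensional ℝ (Matrix (Fin n) (Fin n) ℂ) := inferInstance
    exact ⟨A, contDiffOn_of_expUnitary hlt (hsmooth.congr fun t ht => (hA t ht).2.symm),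
      fun t ht => ⟨(hA t ht).2, hlt t ht⟩⟩
  · have hY0 : Y 0 = 0 := eq_of_exp_I_smul_eq (hY.2 0 hm0).2 (by simpa using Real.pi_pos)
      ((hY.2 0 hm0).1.symm.trans (h0.trans hexp0.symm))
    have hY1 : Y 1 = X := eq_of_exp_I_smul_eq (hY.2 1 hm1).2 hX ((hY.2 1 hm1).1.symm.trans h1)
    have hlog : IsMinimalLog α X Y := ⟨hmin.1, hlen, hX, fun t ht => (hY.2 t ht).2.le,
      fun t ht => (hY.2 t ht).1, hY0, hY1⟩
    have hmono := hlog.monotoneOn_or_antitoneOn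
    have hps : ∀ j, IsPiecewiseSmoothCurve fun t => sortedEigenvalue j (Y t) := fun j =>
      (hpw j).of_exp fun t ht => (hlog.abs_sortedEigenvalue_le ht j).trans_lt hX
    have hlenj : ∀ j, curveLength (fun x : ℝ => |x|) (fun t => sortedEigenvalue j (Y t)) =
        |sortedEigenvalue j (Y 1) - sortedEigenvalue j (Y 0)| := fun j =>
      (hps j).curveLength_eq_of_monotoneOn (hmono j)
    have hz : ∀ j, sortedEigenvalue j (Y 0) = 0 := fun j => by
      have := abs_sortedEigenvalue_le (Y 0) j
      rw [hY0] at this ⊢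
      simpa using this
    refine ⟨fun j => ⟨hmono j, hps j, fun _ _ => Set.mem_univ _, fun β hβ _ hβ0 hβ1 => ?_⟩,
      fun j => ⟨hpw j, fun t _ => ?_, fun β hβ hβS hβ0 hβ1 => ?_⟩⟩
    · rw [hlenj]
      have := hβ.abs_sub_le_curveLength
      rw [hβ0, hβ1] at this
      exact this
    · change ‖Complex.exp _‖ = 1
      rw [mul_comm, Complex.norm_exp_ofReal_mul_I]
    · have e1 : curveLength (fun z : ℂ => ‖z‖) (eigenvalueCurve Y j) =
          |sortedEigenvalue j (Y 1)| := by
        have := (hps j).curveLength_exp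
        rw [hlenj, hz, sub_zero] at this
        exact this
      rw [e1]
      refine abs_le_curveLength_circle hβ hβS ?_ (hlog.abs_sortedEigenvalue_le_pi hm1 j) hβ1
      rw [hβ0, eigenvalueCurve, hz]
      simp
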